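/- **Theorem.** Let $M$ be a finite-dimensional manifold, either a $C^\infty$ manifold over $\mathbb K=\mathbb R$ or a complex manifold over $\mathbb K=\mathbb C$ ("smooth" means $C^\infty$, respectively holomorphic, and functions are $\mathbb K$-valued). Let $\{,\}_1,\{,\}_2$ be a bihamiltonian structure on $M$, i.e. a pair of Poisson brackets all of whose linear combinations $\lambda_1\{,\}_1+\lambda_2\{,\}_2$ are Poisson brackets. If the structure is strictly Lenard-integrable at $m_0\in M$, then there is an open set $U\subset M$ with $m_0\in\overline U$ on which it is homogeneous: there are integers $k_1,\dots,k_l\ge 1$ such that for every $m\in U$ the pair of skew-symmetric pairings induced by the brackets on $T^*_mM\otimes_{\mathbb K}\mathbb C$ is isomorphic to $\bigoplus_{t=1}^{l}\mathcal K_{2k_t-1}$. *Definitions.* - *Kronecker block.* $\mathcal K_{2k-1}$ ($k\ge1$) is the complex vector space with basis $w_0,\dots,w_{2k-2}$ and the two skew-symmetric pairings whose only nonzero values on basis vectors are, up to skew-symmetry, $(w_{2l},w_{2l+1})_1=1$ and $(w_{2l+1},w_{2l+2})_2=1$ for $0\le l\le k-2$. - *Action dimension.* A finite-dimensional complex vector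 space $V$ with two skew-symmetric pairings has action dimension $\frac{\dim V+r}{2}$, where $r$ is the number of Kronecker blocks of $V$, i.e. the largest number of Kronecker blocks occurring in a direct sum decomposition of $V$ (orthogonal for both pairings). The action dimension of the bihamiltonian structure at $m_0$ is the lower limit, as $m\to m_0$, of the action dimensions of $T_m^*M\otimes_{\mathbb K}\mathbb C$. - *Independence.* Smooth functions $F_1,\dots,F_N$ are dependent on an open set $V$ if $\varphi(F_1,\dots,F_N)\equiv0$ on $V$ for some smooth function $\varphi$ on an open set containing all the values $(F_1(m),\dots,F_N(m))$, $m\in V$, such that $\varphi$ does not vanish identically on any nonempty open set. They are independent near $m_0$ if $m_0$ has an open neighbourhood on which they are smooth and which has no nonempty open subset on which they are dependent. - *Anchored Lenard scheme.* It provides, near $m_0$, functions $H_i^{(t)}$, $1\le t\le r$, $0\le i\le k_t$, such that: $H_0^{(1)},\dots,H_0^{(r)}$ are independent Casimir functions of $\{,\}_1$ near $m_0$, and no Casimir function can be added to them keeping independence; $\{H_i^{(t)},f\}_2=-\{H_{i+1}^{(t)},f\}_1$ near $m_0$ for all smooth $f$ and $0\le i<k_t$; all the functions $H_i^{(t)}$,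 $1\le t\le r$, $0\le i\le k_t$, are independent near $m_0$; and adding to them a function $G$ that satisfies $\{H_{k_t}^{(t)},f\}_2=-\{G,f\}_1$ near $m_0$ for all smooth $f$ and some $t$ destroys independence. - *Lenard-integrability.* The structure is Lenard-integrable at $m_0$ if for some such functions the number $\sum_t(k_t+1)$ equals the action dimension at $m_0$. It is strictly Lenard-integrable at $m_0$ if, moreover, for these functions each sequence $H_0^{(t)},\dots,H_{k_t}^{(t)}$ extends to an infinite sequence $(H_i^{(t)})_{i\ge0}$ of functions, each smooth near $m_0$, with $\{H_i^{(t)},f\}_2=-\{H_{i+1}^{(t)},f\}_1$ near $m_0$ for all smooth $f$ and all $i\ge0$ (the neighbourhood may depend on $i$). -/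

import Mathlib

open scoped Manifold ContDiff Topology TensorProduct

noncomputable section

namespace Bihamiltonian

/-! ### Linear algebra: pairs of skew-symmetric pairings and Kronecker blocks -/

section LinearAlgebra

/-- Gram matrix of the first pairing of the Kronecker block of dimension `2 * k + 1` in its
standard basis `w 0, …, w (2 * k)`: the only nonzero pairings are
`(w (2l), w (2l+1))₁ = 1 = -(w (2l+1), w (2l))₁`. -/
def kroneckerFst (k : ℕ) : Matrix (Fin (2 * k + 1)) (Fin (2 * k + 1)) ℂ := fun i j =>
  if Even (i : ℕ) ∧ (j : ℕ) = i + 1 then 1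
  else if Even (j : ℕ) ∧ (i : ℕ) = j + 1 then -1
  else 0

/-- Gram matrix of the second pairing of the Kronecker block of dimension `2 * k + 1`: the only
nonzero pairings are `(w (2l+1), w (2l+2))₂ = 1 = -(w (2l+2), w (2l+1))₂`. -/
def kroneckerSnd (k : ℕ) : Matrix (Fin (2 * k + 1)) (Fin (2 * k + 1)) ℂ := fun i j =>
  if Odd (i : ℕ) ∧ (j : ℕ) = i + 1 then 1
  else if Odd (j : ℕ) ∧ (i : ℕ) = j + 1 then -1
  else 0

variable {W : Type*} [AddCommGroup W] [Module ℂ W]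

/-- The pair `(B₁, B₂)` on `W` is isomorphic to the direct sum of the Kronecker blocks of
dimensions `2 * k t + 1`, `t : Fin l`. -/
def IsKroneckerSum (B₁ B₂ : LinearMap.BilinForm ℂ W) {l : ℕ} (k : Fin l → ℕ) : Prop :=
  ∃ b : Module.Basis (Σ t : Fin l, Fin (2 * k t + 1)) ℂ W, ∀ i j,
    B₁ (b i) (b j) = Matrix.blockDiagonal' (fun t => kroneckerFst (k t)) i j ∧
    B₂ (b i) (b j) = Matrix.blockDiagonal' (fun t => kroneckerSnd (k t)) i j

/-- `W` is the direct sum of `r` Kronecker blocks and of a complementary pair, orthogonal to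
them for both pairings. -/
def SplitsKroneckerBlocks (B₁ B₂ : LinearMap.BilinForm ℂ W) (r : ℕ) : Prop :=
  ∃ P Q : Submodule ℂ W, IsCompl P Q ∧
    (∀ x ∈ P, ∀ y ∈ Q, B₁ x y = 0 ∧ B₂ x y = 0) ∧
    ∃ k : Fin r → ℕ, IsKroneckerSum (B₁.restrict P) (B₂.restrict P) k

/-- The number of Kronecker blocks of a pair of skew-symmetric pairings on a finite-dimensional
complex vector space: the largest number of Kronecker blocks in a direct sum decomposition. -/
def numKroneckerBlocks (B₁ B₂ : LinearMap.BilinForm ℂ W) : ℕ :=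
  sSup {r | SplitsKroneckerBlocks B₁ B₂ r}

/-- The action dimension `(dim W + r) / 2`, with `r` the number of Kronecker blocks. -/
def linearActionDim (B₁ B₂ : LinearMap.BilinForm ℂ W) : ℝ :=
  ((Module.finrank ℂ W : ℝ) + (numKroneckerBlocks B₁ B₂ : ℝ)) / 2

end LinearAlgebra

/-! ### Functions and brackets on a manifold

The field `𝕜` is `ℝ` (smooth manifolds) or `ℂ` (complex manifolds; a map of class `C^∞` over `ℂ`
is holomorphic). The manifold `M` is modelled on the finite-dimensional space `E`. -/

section Manifold

variable {𝕜 : Type*} [RCLike 𝕜]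
  {E : Type*} [NormedAddCommGroup E] [NormedSpace 𝕜 E]
  {M : Type*} [TopologicalSpace M] [ChartedSpace E M]

/-- The cotangent space of `M` at `m`. -/
abbrev Cotangent (𝕜 : Type*) [RCLike 𝕜] (E : Type*) [NormedAddCommGroup E] [NormedSpace 𝕜 E]
    {M : Type*} [TopologicalSpace M] [ChartedSpace E M] (m : M) : Type _ :=
  TangentSpace 𝓘(𝕜, E) m →L[𝕜] 𝕜

/-- The differential of a function at a point. -/
def differential (E : Type*) [NormedAddCommGroup E] [NormedSpace 𝕜 E]
    {M : Type*} [TopologicalSpace M] [ChartedSpace E M] (f : M → 𝕜) (m : M) :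
    Cotangent 𝕜 E m :=
  mfderiv 𝓘(𝕜, E) 𝓘(𝕜, 𝕜) f m

/-- A field of bilinear pairings on the cotangent spaces. -/
abbrev PairingField (𝕜 : Type*) [RCLike 𝕜] (E : Type*) [NormedAddCommGroup E]
    [NormedSpace 𝕜 E] (M : Type*) [TopologicalSpace M] [ChartedSpace E M] : Type _ :=
  (m : M) → LinearMap.BilinForm 𝕜 (Cotangent 𝕜 E m)

/-- The bracket `{f, g}` with associated pairings `η`: `{f, g}|ₘ = (df|ₘ, dg|ₘ)`. It is a
derivation in each argument. -/
def bracket (η : PairingField 𝕜 E M) (f g : M → 𝕜) (m : M) : 𝕜 :=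
  η m (differential E f m) (differential E g m)

/-- `f` is smooth on the set `U`. -/
def SmoothOn (𝕜 : Type*) [RCLike 𝕜] (E : Type*) [NormedAddCommGroup E] [NormedSpace 𝕜 E]
    {M : Type*} [TopologicalSpace M] [ChartedSpace E M] (f : M → 𝕜) (U : Set M) : Prop :=
  ContMDiffOn 𝓘(𝕜, E) 𝓘(𝕜, 𝕜) ∞ f U

/-- `f` is smooth on some neighbourhood of `m`. -/
def SmoothNear (𝕜 : Type*) [RCLike 𝕜] (E : Type*) [NormedAddCommGroup E] [NormedSpace 𝕜 E]
    {M : Type*} [TopologicalSpace M] [ChartedSpace E M] (f : M → 𝕜) (m : M) : Prop :=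
  ∃ U : Set M, IsOpen U ∧ m ∈ U ∧ SmoothOn 𝕜 E f U

/-- The bracket given by `η` is a Poisson bracket: it is skew-symmetric, it takes smooth functions
to smooth functions, and it satisfies the Jacobi identity (all this on open subsets). -/
structure IsPoisson (η : PairingField 𝕜 E M) : Prop where
  alt : ∀ m, (η m).IsAlt
  smooth : ∀ (U : Set M), IsOpen U → ∀ f g : M → 𝕜, SmoothOn 𝕜 E f U → SmoothOn 𝕜 E g U →
    SmoothOn 𝕜 E (bracket η f g) U
  jacobi : ∀ (U : Set M), IsOpen U → ∀ f g h : M → 𝕜,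
    SmoothOn 𝕜 E f U → SmoothOn 𝕜 E g U → SmoothOn 𝕜 E h U → ∀ m ∈ U,
    bracket η f (bracket η g h) m + bracket η g (bracket η h f) m
      + bracket η h (bracket η f g) m = 0

/-- A bihamiltonian structure on `M`: two compatible Poisson brackets. -/
structure BihamiltonianStructure (𝕜 : Type*) [RCLike 𝕜] (E : Type*) [NormedAddCommGroup E]
    [NormedSpace 𝕜 E] (M : Type*) [TopologicalSpace M] [ChartedSpace E M] where
  fst : PairingField 𝕜 E M
  snd : PairingField 𝕜 E M
  compatible : ∀ a b : 𝕜, IsPoisson (fun m => a • fst m + b • snd m)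

/-- The functions `F i` are functionally dependent on `V`: `φ(F) = 0` on `V` for a smooth function
`φ`, defined on an open set containing the values of `F`, that does not vanish identically on any
nonempty open set. -/
def DependentOn {ι : Type*} [Fintype ι] (F : ι → M → 𝕜) (V : Set M) : Prop :=
  ∃ (O : Set (ι → 𝕜)) (φ : (ι → 𝕜) → 𝕜), IsOpen O ∧ ContDiffOn 𝕜 ∞ φ O ∧
    (∀ O' ⊆ O, IsOpen O' → O'.Nonempty → ∃ y ∈ O', φ y ≠ 0) ∧
    ∀ m ∈ V, (fun i => F i m) ∈ O ∧ φ (fun i => F i m) = 0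

/-- The functions `F i` are functionally independent near `m₀`: on some neighbourhood of `m₀` they
are smooth, and are not dependent on any nonempty open subset. -/
def IndependentNear (E : Type*) [NormedAddCommGroup E] [NormedSpace 𝕜 E]
    {M : Type*} [TopologicalSpace M] [ChartedSpace E M]
    {ι : Type*} [Fintype ι] (F : ι → M → 𝕜) (m₀ : M) : Prop :=
  ∃ N : Set M, IsOpen N ∧ m₀ ∈ N ∧ (∀ i, SmoothOn 𝕜 E (F i) N) ∧
    ∀ V ⊆ N, IsOpen V → V.Nonempty → ¬ DependentOn F V

/-- The family `F` with the function `G` added to it. -/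
def adjoin {ι : Type*} (F : ι → M → 𝕜) (G : M → 𝕜) : Option ι → M → 𝕜
  | none => G
  | some i => F i

/-- `F` is a Casimir function, defined near `m₀`, of the bracket given by `η`. -/
def IsCasimirNear (η : PairingField 𝕜 E M) (m₀ : M) (F : M → 𝕜) : Prop :=
  SmoothNear 𝕜 E F m₀ ∧
    ∀ᶠ m in 𝓝 m₀, ∀ f : M → 𝕜, SmoothNear 𝕜 E f m → bracket η F f m = 0

namespace BihamiltonianStructure

variable (P : BihamiltonianStructure 𝕜 E M)

/-- `F` and `G` are consecutive functions of a Lenard chain near `m₀`: `{F, f}₂ = -{G, f}₁` for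
all functions `f`. -/
def IsLenardStep (m₀ : M) (F G : M → 𝕜) : Prop :=
  SmoothNear 𝕜 E F m₀ ∧ SmoothNear 𝕜 E G m₀ ∧
    ∀ᶠ m in 𝓝 m₀, ∀ f : M → 𝕜, SmoothNear 𝕜 E f m →
      bracket P.snd F f m = - bracket P.fst G f m

/-- The functions `H t i`, `i ≤ k t`, are obtained near `m₀` by the anchored Lenard scheme. -/
structure IsAnchoredLenardScheme (m₀ : M) {r : ℕ} (k : Fin r → ℕ)
    (H : Fin r → ℕ → M → 𝕜) : Prop where
  /-- the initial functions are independent Casimir functions of the first bracket, -/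
  casimir : ∀ t, IsCasimirNear P.fst m₀ (H t 0)
  initial_independent : IndependentNear E (fun t => H t 0) m₀
  /-- and no further independent Casimir function can be added; -/
  initial_maximal : ∀ G, IsCasimirNear P.fst m₀ G →
    ¬ IndependentNear E (adjoin (fun t => H t 0) G) m₀
  /-- the recurrence relations hold, -/
  recurrence : ∀ t, ∀ i < k t, P.IsLenardStep m₀ (H t i) (H t (i + 1))
  /-- the functions obtained are independent, -/
  independent : IndependentNear E (fun p : (Σ t : Fin r, Fin (k t + 1)) => H p.1 p.2) m₀
  /-- and a further step in any of the chains gives a function that depends on them. -/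
  stops : ∀ t G, P.IsLenardStep m₀ (H t (k t)) G →
    ¬ IndependentNear E
      (adjoin (fun p : (Σ t : Fin r, Fin (k t + 1)) => H p.1 p.2) G) m₀

section Complexified

variable [Algebra 𝕜 ℂ]

/-- The first pairing on the complexified cotangent space at `m`. -/
def complexFst (m : M) : LinearMap.BilinForm ℂ (ℂ ⊗[𝕜] Cotangent 𝕜 E m) :=
  (P.fst m).baseChange ℂ

/-- The second pairing on the complexified cotangent space at `m`. -/
def complexSnd (m : M) : LinearMap.BilinForm ℂ (ℂ ⊗[𝕜] Cotangent 𝕜 E m) :=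
  (P.snd m).baseChange ℂ

/-- The action dimension at `m₀`: the lower limit, as `m` tends to `m₀`, of the action dimensions
of the complexified cotangent spaces at `m`. -/
def actionDimAt (m₀ : M) : ℝ :=
  Filter.liminf (fun m => linearActionDim (P.complexFst m) (P.complexSnd m)) (𝓝 m₀)

/-- Lenard-integrability at `m₀`, with the functions it rests on. -/
def IsLenardIntegrableWith (m₀ : M) {r : ℕ} (k : Fin r → ℕ) (H : Fin r → ℕ → M → 𝕜) : Prop :=
  P.IsAnchoredLenardScheme m₀ k H ∧ ((∑ t, (k t + 1) : ℕ) : ℝ) = P.actionDimAt m₀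

/-- Lenard-integrability at `m₀`: the number of independent functions provided by the anchored
Lenard scheme near `m₀` is the action dimension at `m₀`. -/
def IsLenardIntegrableAt (m₀ : M) : Prop :=
  ∃ (r : ℕ) (k : Fin r → ℕ) (H : Fin r → ℕ → M → 𝕜), P.IsLenardIntegrableWith m₀ k H

/-- Strict Lenard-integrability at `m₀`: moreover, the chains continue indefinitely beyond the
independent functions. -/
def IsStrictlyLenardIntegrableAt (m₀ : M) : Prop :=
  ∃ (r : ℕ) (k : Fin r → ℕ) (H : Fin r → ℕ → M → 𝕜), P.IsLenardIntegrableWith m₀ k H ∧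
    ∀ t i, P.IsLenardStep m₀ (H t i) (H t (i + 1))

/-- The structure is homogeneous of type `(2 * k t + 1)ₜ` on `U`: at each point of `U` the pair of
pairings on the complexified cotangent space is the direct sum of Kronecker blocks of these
dimensions. -/
def IsHomogeneousOfTypeOn (U : Set M) {l : ℕ} (k : Fin l → ℕ) : Prop :=
  ∀ m ∈ U, IsKroneckerSum (P.complexFst m) (P.complexSnd m) k

/-- The structure is homogeneous (of some type) on `U`. -/
def IsHomogeneousOn (U : Set M) : Prop :=
  ∃ (l : ℕ) (k : Fin l → ℕ), P.IsHomogeneousOfTypeOn U k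

end Complexified

end BihamiltonianStructure

end Manifold

end Bihamiltonian

end

open scoped Manifold ContDiff Topology TensorProduct

noncomputable section

/-! The argument is linear algebra at each point, followed by a semicontinuity argument on `M`.

Linear algebra. A pencil `B₁ + λ B₂` of skew pairings that is degenerate for every `λ` has a
polynomial `z(λ)` in its kernel, and one of minimal degree splits off a Kronecker block
(`exists_block_frame`). Hence a frame with the maximal number `ρ` of blocks leaves a complement on
which some pairing of the pencil is nondegenerate. Consider a Lenard chain: `B₁ q₀ = 0`, `B₁ qᵢ₊₁ =
-B₂ qᵢ`. Its odd coordinates in the blocks vanish. Its component in the complement vanishes too,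
provided the chain goes on for `n = dim W` further steps (`chain_eq_zero`). This is where strictness
enters: it excludes chains that live in Jordan blocks and break off. So such a chain lies in the
span of the even vectors, whose dimension is `∑ (kₜ + 1) = (n - c + ρ) / 2`, with `c` the dimension
of the complement. If the chains contain at least `(n + ρ) / 2` independent vectors, then `c = 0`
and the pair is a sum of Kronecker blocks (`exists_frame_compl_eq_bot_of_chains`).

Genericity. Functionally independent functions have linearly independent differentials on a dense
open subset of a neighbourhood of `m₀` (`IndependentNear.exists_linearIndependent`, by the rank
theorem). The action dimension equals the number of functions, so arbitrarily near `m₀` there are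
points with few enough blocks for the count above. The number of blocks is upper semicontinuous, so
the bound persists on open sets, and these meet the dense set.

Constant type. The kernel polynomials of degree less than `d` form a space of dimension `∑ (d -
kₜ)⁺`, which is upper semicontinuous in the point. These dimensions determine the sizes of the
blocks, and a point where their sum over `d` is minimal has a neighbourhood of constant type. Only
finitely many types occur in a given dimension, so the open set of points of one of them has `m₀` in
its closure (`exists_isOpen_isKroneckerSum`). -/

namespace Bihamiltonian

/-! ### Kronecker frames -/

section Frames

variable {W : Type*} [AddCommGroup W] [Module ℂ W]

/-- A direct sum of Kronecker blocks of dimensions `2 * k t + 1`, `t : T`, inside `W`, given by its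
even and odd basis vectors and by functionals dual to them; a complement orthogonal to the blocks
is the common kernel of the functionals. Only the indices `l ≤ k t` of even vectors and `l < k t`
of odd vectors matter. -/
structure KroneckerFrame (B₁ B₂ : LinearMap.BilinForm ℂ W) (T : Type*) (k : T → ℕ) where
  even : T → ℕ → W
  odd : T → ℕ → W
  evenCoord : T → ℕ → Module.Dual ℂ W
  oddCoord : T → ℕ → Module.Dual ℂ W
  evenCoord_even : ∀ s t i j, i ≤ k s → j ≤ k t → s = t → i = j → evenCoord s i (even t j) = 1
  evenCoord_even_ne : ∀ s t i j, i ≤ k s → j ≤ k t → (s ≠ t ∨ i ≠ j) →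
    evenCoord s i (even t j) = 0
  evenCoord_odd : ∀ s t i j, i ≤ k s → j < k t → evenCoord s i (odd t j) = 0
  oddCoord_even : ∀ s t i j, i < k s → j ≤ k t → oddCoord s i (even t j) = 0
  oddCoord_odd : ∀ s t i j, i < k s → j < k t → s = t → i = j → oddCoord s i (odd t j) = 1
  oddCoord_odd_ne : ∀ s t i j, i < k s → j < k t → (s ≠ t ∨ i ≠ j) →
    oddCoord s i (odd t j) = 0
  fst_even : ∀ t l y, l < k t → B₁ (even t l) y = oddCoord t l y
  fst_last : ∀ t y, B₁ (even t (k t)) y = 0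
  fst_odd : ∀ t l y, l < k t → B₁ (odd t l) y = - evenCoord t l y
  snd_zero : ∀ t y, B₂ (even t 0) y = 0
  snd_even : ∀ t l y, l < k t → B₂ (even t (l + 1)) y = - oddCoord t l y
  snd_odd : ∀ t l y, l < k t → B₂ (odd t l) y = evenCoord t (l + 1) y

/-- `z 0, …, z d` are the coefficients of a polynomial of degree `d` in the kernel of the pencil
`B₁ + λ B₂`. -/
structure IsKernelChain (B₁ B₂ : LinearMap.BilinForm ℂ W) (d : ℕ) (z : ℕ → W) : Prop where
  fst_zero : B₁ (z 0) = 0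
  step : ∀ i < d, B₁ (z (i + 1)) = - B₂ (z i)
  snd_last : B₂ (z d) = 0
  ne_zero : z d ≠ 0

variable {B₁ B₂ : LinearMap.BilinForm ℂ W}

/-- A kernel polynomial of minimal degree `d + 1` is paired with a chain of `d + 1` vectors. -/
theorem IsKernelChain.exists_dual_chain [FiniteDimensional ℂ W]
    (h₁ : ∀ x y, B₁ x y = - B₁ y x) (h₂ : ∀ x y, B₂ x y = - B₂ y x) {d : ℕ} {z : ℕ → W}
    (hz : IsKernelChain B₁ B₂ (d + 1) z) (hmin : ∀ z', ¬ IsKernelChain B₁ B₂ d z') :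
    ∃ u : ℕ → W, (∀ m < d, B₁ (u (m + 1)) = - B₂ (u m)) ∧ B₁ (z (d + 1)) (u 0) = 1 := by
  classical
  let g : Module.Dual ℂ (ℕ → W) := (B₁ (z (d + 1))).comp (LinearMap.proj 0)
  -- The range of `Θ` consists of the linear consequences of the equations required of `u`. The
  -- system with the normalization `g u = 1` is solvable exactly when `g` is not such a consequence.
  let Θ : (Fin d → W) →ₗ[ℂ] Module.Dual ℂ (ℕ → W) :=
    ∑ m : Fin d, (LinearMap.comp (LinearMap.lcomp ℂ ℂ (LinearMap.proj (m + 1 : ℕ)))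
        (LinearMap.comp (LinearMap.flip B₁) (LinearMap.proj m)) +
      LinearMap.comp (LinearMap.lcomp ℂ ℂ (LinearMap.proj (m : ℕ)))
        (LinearMap.comp (LinearMap.flip B₂) (LinearMap.proj m)))
  have hΘ : ∀ y u, Θ y u = ∑ m : Fin d, (B₁ (u (m + 1)) (y m) + B₂ (u m) (y m)) := by
    intro y u
    simp [Θ, LinearMap.sum_apply]
  by_cases hg : g ∈ LinearMap.range Θ
  · exfalso
    obtain ⟨y, hy⟩ := hg
    let y' : ℕ → W := fun m => if h : m < d then y ⟨m, h⟩ else 0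
    have hy' : ∀ u : ℕ → W, B₁ (z (d + 1)) (u 0) =
        ∑ m ∈ Finset.range d, (B₁ (u (m + 1)) (y' m) + B₂ (u m) (y' m)) := by
      intro u
      rw [Finset.sum_range]
      have := (DFunLike.congr_fun hy u).symm
      rw [hΘ] at this
      simpa [g, y'] using this
    -- If `g` is a consequence, its coefficients together with `z (d + 1)`, read backwards, form a
    -- kernel polynomial of degree `d`, against minimality.
    let e : ℕ → W := fun p => match p with
      | 0 => z (d + 1)
      | m + 1 => y' m
    have he : ∀ p ≤ d, B₁ (e p) = - B₂ (e (p + 1)) := by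
      intro p hp
      ext w
      have := hy' (Pi.single p w)
      simp only [Finset.sum_add_distrib] at this
      have e2 : ∑ m ∈ Finset.range d, (B₂ ((Pi.single p w : ℕ → W) m)) (y' m) = B₂ w (y' p) := by
        rcases hp.lt_or_eq with hlt | rfl
        · rw [Finset.sum_eq_single p]
          · simp
          · intro m _ hm
            simp [Pi.single_eq_of_ne hm]
          · intro h
            exact absurd (Finset.mem_range.2 hlt) h
        · rw [Finset.sum_eq_zero]
          · simp [y']
          · intro m hm
            simp [Pi.single_eq_of_ne (Finset.mem_range.1 hm).ne]
      rw [e2] at this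
      cases p with
      | zero =>
        rw [Finset.sum_eq_zero (fun m _ => by simp)] at this
        simp only [Pi.single_eq_same, zero_add] at this
        simp only [e, zero_add, LinearMap.neg_apply, this]
        exact h₂ _ _
      | succ q =>
        have e1 : ∑ m ∈ Finset.range d, (B₁ ((Pi.single (q + 1) w : ℕ → W) (m + 1))) (y' m)
            = B₁ w (y' q) := by
          rw [Finset.sum_eq_single q]
          · simp
          · intro m _ hm
            rw [Pi.single_eq_of_ne (by omega)]
            simp
          · intro h
            exact absurd (Finset.mem_range.2 hp) h
        rw [e1] at this
        simp only [ne_eq, Nat.zero_ne_add_one, not_false_eq_true, Pi.single_eq_of_ne, map_zero]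
          at this
        simp only [e, LinearMap.neg_apply]
        rw [h₁, h₂ (y' (q + 1))]
        linear_combination this
    refine hmin (fun i => e (d - i)) ⟨?_, ?_, ?_, ?_⟩
    · have := he d le_rfl
      simpa [e, y'] using this
    · intro i hi
      have := he (d - (i + 1)) (by omega)
      rwa [show d - (i + 1) + 1 = d - i by omega] at this
    · simpa [e] using hz.snd_last
    · simpa [e] using hz.ne_zero
  -- The range of `Θ` is finite-dimensional, hence equal to its double annihilator, although `ℕ → W`
  -- is infinite-dimensional.
  · have hx : ∃ x ∈ (LinearMap.range Θ).dualCoannihilator, g x ≠ 0 := by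
      by_contra! hcon
      apply hg
      rw [← Subspace.dualCoannihilator_dualAnnihilator_eq (W := LinearMap.range Θ)]
      exact (Submodule.mem_dualAnnihilator _).2 hcon
    obtain ⟨x, hx, hgx⟩ := hx
    refine ⟨fun i => (g x)⁻¹ • x i, ?_, ?_⟩
    · intro m hm
      have hsum : ∀ w, B₁ (x (m + 1)) w + B₂ (x m) w = 0 := by
        intro w
        have := (Submodule.mem_dualCoannihilator _).1 hx (Θ (Pi.single ⟨m, hm⟩ w)) ⟨_, rfl⟩
        rw [hΘ, Finset.sum_eq_single ⟨m, hm⟩] at this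
        · simpa using this
        · intro b _ hb
          simp [Pi.single_eq_of_ne hb]
        · simp
      ext w
      simp only [map_smul, LinearMap.smul_apply, LinearMap.neg_apply, smul_eq_mul]
      linear_combination (g x)⁻¹ * hsum w
    · simp only [map_smul, smul_eq_mul]
      exact inv_mul_cancel₀ hgx

end Frames

/-! ### Splitting a Kronecker block off a degenerate pencil -/

section Frames

variable {W : Type*} [AddCommGroup W] [Module ℂ W] {B₁ B₂ : LinearMap.BilinForm ℂ W}

theorem apply_self_eq_zero_of_skew {B : LinearMap.BilinForm ℂ W}
    (h : ∀ x y, B x y = - B y x) (x : W) : B x x = 0 :=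
  self_eq_neg.1 (h x x)

/-- The vectors of a kernel chain pair trivially with each other. -/
theorem IsKernelChain.isotropic
    (h₁ : ∀ x y, B₁ x y = - B₁ y x) (h₂ : ∀ x y, B₂ x y = - B₂ y x) {d : ℕ} {z : ℕ → W}
    (hz : IsKernelChain B₁ B₂ d z) {i j : ℕ} (hi : i ≤ d) (hj : j ≤ d) : B₁ (z i) (z j) = 0 := by
  induction i generalizing j with
  | zero => simp [hz.fst_zero]
  | succ i ih =>
    rw [hz.step i hi, LinearMap.neg_apply, ← h₂]
    rcases hj.lt_or_eq with hj | rfl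
    · rw [← neg_eq_iff_eq_neg.2 (DFunLike.congr_fun (hz.step j hj) (z i)), ← h₁]
      · exact ih (by omega) hj
    · simp [hz.snd_last]

/-- By the recurrence `B₁ (u l) (u m)` depends only on `l + m`, so it is symmetric in `l` and `m` as
well as skew. The values of `B₂` reduce to those of `B₁`, except at `l = m = d`, where skewness
suffices. -/
theorem dual_chain_isotropic
    (h₁ : ∀ x y, B₁ x y = - B₁ y x) (h₂ : ∀ x y, B₂ x y = - B₂ y x) {d : ℕ} {u : ℕ → W}
    (hu : ∀ m < d, B₁ (u (m + 1)) = - B₂ (u m)) :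
    (∀ l ≤ d, ∀ m ≤ d, B₁ (u l) (u m) = 0) ∧ ∀ l ≤ d, ∀ m ≤ d, B₂ (u l) (u m) = 0 := by
  have hstep : ∀ l < d, ∀ m < d, B₁ (u (l + 1)) (u m) = B₁ (u l) (u (m + 1)) := by
    intro l hl m hm
    rw [h₁ (u l), hu l hl, hu m hm, LinearMap.neg_apply, LinearMap.neg_apply, h₂]
  have hshift : ∀ j l m, l + j ≤ d → m + j ≤ d → B₁ (u l) (u (m + j)) = B₁ (u (l + j)) (u m) := by
    intro j
    induction j with
    | zero => simp
    | succ j ih =>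
      intro l m hl hm
      rw [← add_assoc, ← add_assoc, hstep (l + j) hl m (by omega), ← ih l (m + 1) (by omega)
        (by omega)]
      congr 2
      omega
  have hle : ∀ l m, l ≤ m → m ≤ d → B₁ (u l) (u m) = 0 := by
    intro l m hlm hm
    obtain ⟨j, rfl⟩ := Nat.exists_eq_add_of_le hlm
    have := hshift j l l hm hm
    rw [h₁ (u (l + j))] at this
    exact self_eq_neg.1 this
  have hfst : ∀ l ≤ d, ∀ m ≤ d, B₁ (u l) (u m) = 0 := by
    intro l hl m hm
    rcases le_total l m with h | h
    · exact hle l m h hm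
    · rw [h₁, hle m l h hl, neg_zero]
  have hlt : ∀ l < d, ∀ m ≤ d, B₂ (u l) (u m) = 0 := by
    intro l hl m hm
    have := hfst (l + 1) hl m hm
    rw [hu l hl, LinearMap.neg_apply] at this
    exact neg_eq_zero.1 this
  refine ⟨hfst, fun l hl m hm => ?_⟩
  rcases hl.lt_or_eq with hl | rfl
  · exact hlt l hl m hm
  · rcases hm.lt_or_eq with hm' | rfl
    · rw [h₂, hlt m hm' l le_rfl, neg_zero]
    · exact apply_self_eq_zero_of_skew h₂ _

/-- A kernel chain and a chain dual to it at one place are dual bases. -/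
theorem IsKernelChain.apply_dual_chain
    (h₁ : ∀ x y, B₁ x y = - B₁ y x) (h₂ : ∀ x y, B₂ x y = - B₂ y x) {d : ℕ} {z u : ℕ → W}
    (hz : IsKernelChain B₁ B₂ (d + 1) z) (hu : ∀ m < d, B₁ (u (m + 1)) = - B₂ (u m))
    (hzu : B₁ (z (d + 1)) (u 0) = 1) {i m : ℕ} (hi : i ≤ d + 1) (hm : m ≤ d) :
    B₁ (z i) (u m) = if i + m = d + 1 then 1 else 0 := by
  have hstep : ∀ i ≤ d, ∀ m < d, B₁ (z i) (u (m + 1)) = B₁ (z (i + 1)) (u m) := by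
    intro i hi m hm
    rw [h₁, hu m hm, hz.step i (by omega), LinearMap.neg_apply, LinearMap.neg_apply, h₂]
    simp
  have hlow : ∀ i m, i + m ≤ d → B₁ (z i) (u m) = 0 := by
    intro i
    induction i with
    | zero => simp [hz.fst_zero]
    | succ i ih =>
      intro m him
      rw [← hstep i (by omega) m (by omega)]
      exact ih (m + 1) (by omega)
  induction m generalizing i with
  | zero =>
    rcases hi.lt_or_eq with h | rfl
    · rw [hlow i 0 (by omega), if_neg (by omega)]
    · simpa using hzu
  | succ m ih =>
    rcases hi.lt_or_eq with h | rfl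
    · rw [hstep i (by omega) m (by omega), ih (by omega) (by omega)]
      congr 1
      apply propext
      omega
    · rw [h₁, hu m (by omega), LinearMap.neg_apply, neg_neg, h₂, hz.snd_last, if_neg (by omega)]
      simp

/-- A kernel polynomial of minimal degree spans half of a Kronecker block. -/
theorem IsKernelChain.exists_frame [FiniteDimensional ℂ W]
    (h₁ : ∀ x y, B₁ x y = - B₁ y x) (h₂ : ∀ x y, B₂ x y = - B₂ y x) {d : ℕ} {z : ℕ → W}
    (hz : IsKernelChain B₁ B₂ d z) (hmin : ∀ d' < d, ∀ z', ¬ IsKernelChain B₁ B₂ d' z') :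
    Nonempty (KroneckerFrame B₁ B₂ Unit fun _ => d) := by
  cases d with
  | zero =>
    -- In degree zero the block is a line in the common kernel, and any functional nonzero on it
    -- defines a complement.
    obtain ⟨f, hf⟩ : ∃ f : Module.Dual ℂ W, f (z 0) ≠ 0 := by
      by_contra! hcon
      exact hz.ne_zero ((Module.forall_dual_apply_eq_zero_iff ℂ (z 0)).1 hcon)
    exact ⟨{
      even := fun _ _ => z 0
      odd := fun _ _ => 0
      evenCoord := fun _ _ => (f (z 0))⁻¹ • f
      oddCoord := fun _ _ => 0
      evenCoord_even := fun _ _ _ _ _ _ _ _ => by simp [hf]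
      evenCoord_even_ne := fun s t i j hi hj h => by simp at h; omega
      evenCoord_odd := fun _ _ _ _ _ h => by omega
      oddCoord_even := fun _ _ _ _ h _ => by omega
      oddCoord_odd := fun _ _ _ _ h => by omega
      oddCoord_odd_ne := fun _ _ _ _ h => by omega
      fst_even := fun _ _ _ h => by omega
      fst_last := fun _ y => by simp [hz.fst_zero]
      fst_odd := fun _ _ _ h => by omega
      snd_zero := fun _ y => by simp [hz.snd_last]
      snd_even := fun _ _ _ h => by omega
      snd_odd := fun _ _ _ h => by omega }⟩
  | succ d =>
    obtain ⟨u, hu, hzu⟩ := hz.exists_dual_chain h₁ h₂ (hmin d (by omega))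
    have hdual := fun {i m : ℕ} (hi : i ≤ d + 1) (hm : m ≤ d) =>
      hz.apply_dual_chain h₁ h₂ hu hzu hi hm
    obtain ⟨hiso₁, hiso₂⟩ := dual_chain_isotropic h₁ h₂ hu
    -- The relations of a frame force these functionals. For the last index there is no `u (d + 1)`,
    -- and `B₂ (u d)` takes the place of `-B₁ (u (d + 1))`.
    have heven : ∀ i j, i ≤ d + 1 → j ≤ d + 1 →
        (if i = d + 1 then B₂ (u d) else - B₁ (u i)) (z (d + 1 - j)) = if i = j then 1 else 0 := by
      intro i j hi hj
      split_ifs with hid hij hij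
      · subst hid; subst hij
        have := hdual (i := 1) (m := d) (by omega) le_rfl
        rw [if_pos (by omega), hz.step 0 (by omega)] at this
        rw [h₂]
        simpa using this
      · rcases Nat.eq_zero_or_pos j with rfl | hj0
        · rw [h₂]
          simp [hz.snd_last]
        · have := hdual (i := d + 1 - j + 1) (m := d) (by omega) le_rfl
          rw [if_neg (by omega), hz.step _ (by omega)] at this
          rw [h₂]
          simpa using this
      · rw [LinearMap.neg_apply, ← h₁, hdual (by omega) (by omega), if_pos (by omega)]
      · rw [LinearMap.neg_apply, ← h₁, hdual (by omega) (by omega), if_neg (by omega)]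
    exact ⟨{
      even := fun _ l => z (d + 1 - l)
      odd := fun _ l => u l
      evenCoord := fun _ l => if l = d + 1 then B₂ (u d) else - B₁ (u l)
      oddCoord := fun _ l => B₁ (z (d + 1 - l))
      evenCoord_even := fun _ _ i j hi hj _ hij => by rw [heven i j hi hj, if_pos hij]
      evenCoord_even_ne := fun _ _ i j hi hj h => by
        rw [heven i j hi hj, if_neg (by simpa using h)]
      evenCoord_odd := fun _ _ i j hi hj => by
        split_ifs with h
        · exact hiso₂ _ le_rfl _ (by omega)
        · rw [LinearMap.neg_apply, hiso₁ _ (by omega) _ (by omega), neg_zero]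
      oddCoord_even := fun _ _ i j hi hj => hz.isotropic h₁ h₂ (by omega) (by omega)
      oddCoord_odd := fun _ _ i j hi hj _ hij => by
        rw [hdual (by omega) (by omega), if_pos (by omega)]
      oddCoord_odd_ne := fun _ _ i j hi hj h => by
        have : i ≠ j := by simpa using h
        rw [hdual (by omega) (by omega), if_neg (by omega)]
      fst_even := fun _ l y hl => rfl
      fst_last := fun _ y => by simp [hz.fst_zero]
      fst_odd := fun _ l y hl => by rw [if_neg (by omega)]; simp
      snd_zero := fun _ y => by simp [hz.snd_last]
      snd_even := fun _ l y hl => by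
        have := hz.step (d + 1 - (l + 1)) (by omega)
        rw [show d + 1 - (l + 1) + 1 = d + 1 - l by omega] at this
        rw [this]
        simp
      snd_odd := fun _ l y hl => by
        split_ifs with h
        · rw [show l = d by omega]
        · rw [hu l (by omega)]
          simp }⟩

/-- If all the pairings of the pencil are degenerate, it has a kernel polynomial. -/
theorem exists_isKernelChain [FiniteDimensional ℂ W]
    (hdeg : ∀ c : ℂ, ∃ x, x ≠ 0 ∧ ∀ y, B₁ x y + c * B₂ x y = 0) :
    ∃ d z, IsKernelChain B₁ B₂ d z := by
  classical
  let e := Module.finBasis ℂ W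
  let A (B : LinearMap.BilinForm ℂ W) : Matrix (Fin (Module.finrank ℂ W)) (Fin (Module.finrank ℂ W)) ℂ :=
    Matrix.of fun j i => B (e i) (e j)
  have hA : ∀ B x j, (A B).mulVec (e.repr x) j = B x (e j) := by
    intro B x j
    have := congrArg (fun w => B w (e j)) (e.sum_repr x)
    simp only [map_sum, map_smul, LinearMap.sum_apply, LinearMap.smul_apply, smul_eq_mul] at this
    rw [← this]
    simp [Matrix.mulVec, dotProduct, A, mul_comm]
  let Mp : Matrix (Fin (Module.finrank ℂ W)) (Fin (Module.finrank ℂ W)) (Polynomial ℂ) :=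
    (A B₁).map Polynomial.C + (Polynomial.X : Polynomial ℂ) • (A B₂).map Polynomial.C
  have hdet : Mp.det = 0 := by
    apply Polynomial.funext
    intro c
    rw [Polynomial.eval_zero, ← Polynomial.coe_evalRingHom, RingHom.map_det]
    have hM : (Polynomial.evalRingHom c).mapMatrix Mp = A B₁ + c • A B₂ := by
      ext i j
      simp [Mp, mul_comm c]
    rw [hM, ← Matrix.exists_mulVec_eq_zero_iff]
    obtain ⟨x, hx, hxy⟩ := hdeg c
    refine ⟨e.repr x, fun h => hx (e.repr.map_eq_zero_iff.1 (DFunLike.coe_injective h)), ?_⟩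
    ext j
    rw [Matrix.add_mulVec, Matrix.smul_mulVec]
    simp only [Pi.add_apply, Pi.smul_apply, hA, smul_eq_mul, hxy, Pi.zero_apply]
  -- The determinant vanishes over the domain `ℂ[X]`, so a kernel vector exists with polynomial
  -- entries; its coefficients are the chain.
  obtain ⟨v, hv, hMv⟩ := Matrix.exists_mulVec_eq_zero_iff.2 hdet
  let z : ℕ → W := fun i => ∑ p, (v p).coeff i • e p
  have hz : ∀ i p, e.repr (z i) p = (v p).coeff i := by
    intro i p
    simp [z, Finsupp.single_apply]
  have hcoeff : ∀ B i j, ∑ p, ((A B).map Polynomial.C j p * v p).coeff i = B (z i) (e j) := by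
    intro B i j
    rw [← hA]
    simp [Matrix.mulVec, dotProduct, hz]
  have hrel : ∀ j, ∑ p, (A B₁).map Polynomial.C j p * v p +
      Polynomial.X * ∑ p, (A B₂).map Polynomial.C j p * v p = 0 := by
    intro j
    have := congrFun hMv j
    simpa [Mp, Matrix.mulVec, dotProduct, add_mul, Finset.sum_add_distrib, Finset.mul_sum,
      mul_assoc, mul_left_comm Polynomial.X] using this
  have hfst : B₁ (z 0) = 0 := by
    refine e.ext fun j => ?_
    have := congrArg (fun q => Polynomial.coeff q 0) (hrel j)
    simp only [Polynomial.coeff_add, Polynomial.finsetSum_coeff, hcoeff,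
      Polynomial.coeff_X_mul_zero, add_zero,
      Polynomial.coeff_zero] at this
    simpa using this
  have hstep : ∀ i, B₁ (z (i + 1)) = - B₂ (z i) := by
    intro i
    refine e.ext fun j => ?_
    have := congrArg (fun q => Polynomial.coeff q (i + 1)) (hrel j)
    simp only [Polynomial.coeff_add, Polynomial.finsetSum_coeff, hcoeff,
      Polynomial.coeff_X_mul, Polynomial.coeff_zero] at this
    rw [LinearMap.neg_apply]
    linear_combination this
  obtain ⟨p₀, hp₀⟩ := Function.ne_iff.1 hv
  let s := Finset.univ.sup fun p => (v p).natDegree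
  have hbig : ∀ i > s, z i = 0 := by
    intro i hi
    refine Finset.sum_eq_zero fun p _ => ?_
    rw [Polynomial.coeff_eq_zero_of_natDegree_lt, zero_smul]
    exact lt_of_le_of_lt (Finset.le_sup (f := fun p => (v p).natDegree) (Finset.mem_univ p)) hi
  -- The chain has to end at its last nonzero coefficient, so the least such `d` is taken.
  have hex : ∃ d, ∀ i > d, z i = 0 := ⟨s, hbig⟩
  have hne : z (v p₀).natDegree ≠ 0 := by
    intro h
    have := hz (v p₀).natDegree p₀
    rw [h] at this
    simp only [map_zero, Finsupp.coe_zero, Pi.zero_apply] at this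
    exact hp₀ (Polynomial.leadingCoeff_eq_zero.1 this.symm)
  refine ⟨Nat.find hex, z, hfst, fun i _ => hstep i, ?_, ?_⟩
  · have := hstep (Nat.find hex)
    rw [Nat.find_spec hex _ (Nat.lt_succ_self _), map_zero] at this
    exact neg_eq_zero.1 this.symm
  · intro h0
    rcases Nat.eq_zero_or_pos (Nat.find hex) with h | h
    · apply hne
      rcases Nat.eq_zero_or_pos (v p₀).natDegree with h' | h'
      · rw [h', ← h, h0]
      · exact Nat.find_spec hex _ (h ▸ h')
    · refine Nat.find_min hex (m := Nat.find hex - 1) (by omega) fun i hi => ?_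
      rcases eq_or_ne i (Nat.find hex) with rfl | hi'
      · exact h0
      · exact Nat.find_spec hex i (by omega)

/-- A pencil of degenerate skew-symmetric pairings splits off a Kronecker block. -/
theorem exists_block_frame [FiniteDimensional ℂ W]
    (h₁ : ∀ x y, B₁ x y = - B₁ y x) (h₂ : ∀ x y, B₂ x y = - B₂ y x)
    (hdeg : ∀ c : ℂ, ∃ x, x ≠ 0 ∧ ∀ y, B₁ x y + c * B₂ x y = 0) :
    ∃ d : ℕ, Nonempty (KroneckerFrame B₁ B₂ Unit fun _ => d) := by
  classical
  have hex := exists_isKernelChain hdeg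
  obtain ⟨z, hz⟩ := Nat.find_spec hex
  exact ⟨_, hz.exists_frame h₁ h₂ fun d' hd' z' hz' => Nat.find_min hex hd' ⟨z', hz'⟩⟩

end Frames

/-! ### Rows of the Gram matrices of sums of Kronecker blocks -/

section Rows

open Matrix

variable {T : Type*} [DecidableEq T] {k : T → ℕ}

theorem blockDiagonal_kroneckerFst_even {t : T} {l : ℕ} (hl : l < k t)
    (j : Σ t, Fin (2 * k t + 1)) :
    blockDiagonal' (fun t => kroneckerFst (k t)) ⟨t, ⟨2 * l, by omega⟩⟩ j =
      if j = ⟨t, ⟨2 * l + 1, by omega⟩⟩ then 1 else 0 := by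
  obtain ⟨s, j, hj⟩ := j
  rcases eq_or_ne t s with rfl | hts
  · rw [blockDiagonal'_apply_eq]
    simp only [kroneckerFst, Nat.even_iff, Sigma.mk.injEq, heq_eq_eq, true_and, Fin.mk.injEq]
    split_ifs <;> first | rfl | omega
  · rw [blockDiagonal'_apply_ne _ _ _ hts, if_neg fun h => hts (congrArg Sigma.fst h).symm]

theorem blockDiagonal_kroneckerFst_last (t : T) (j : Σ t, Fin (2 * k t + 1)) :
    blockDiagonal' (fun t => kroneckerFst (k t)) ⟨t, ⟨2 * k t, by omega⟩⟩ j = 0 := by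
  obtain ⟨s, j, hj⟩ := j
  rcases eq_or_ne t s with rfl | hts
  · rw [blockDiagonal'_apply_eq]
    simp only [kroneckerFst, Nat.even_iff]
    split_ifs <;> first | rfl | omega
  · rw [blockDiagonal'_apply_ne _ _ _ hts]

theorem blockDiagonal_kroneckerFst_odd {t : T} {l : ℕ} (hl : l < k t)
    (j : Σ t, Fin (2 * k t + 1)) :
    blockDiagonal' (fun t => kroneckerFst (k t)) ⟨t, ⟨2 * l + 1, by omega⟩⟩ j =
      if j = ⟨t, ⟨2 * l, by omega⟩⟩ then -1 else 0 := by
  obtain ⟨s, j, hj⟩ := j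
  rcases eq_or_ne t s with rfl | hts
  · rw [blockDiagonal'_apply_eq]
    simp only [kroneckerFst, Nat.even_iff, Sigma.mk.injEq, heq_eq_eq, true_and, Fin.mk.injEq]
    split_ifs <;> first | rfl | omega
  · rw [blockDiagonal'_apply_ne _ _ _ hts, if_neg fun h => hts (congrArg Sigma.fst h).symm]

theorem blockDiagonal_kroneckerSnd_zero (t : T) (j : Σ t, Fin (2 * k t + 1)) :
    blockDiagonal' (fun t => kroneckerSnd (k t)) ⟨t, ⟨2 * 0, by omega⟩⟩ j = 0 := by
  obtain ⟨s, j, hj⟩ := j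
  rcases eq_or_ne t s with rfl | hts
  · rw [blockDiagonal'_apply_eq]
    simp only [kroneckerSnd, Nat.odd_iff]
    rw [if_neg (by simp), if_neg (by simp)]
  · rw [blockDiagonal'_apply_ne _ _ _ hts]

theorem blockDiagonal_kroneckerSnd_even {t : T} {l : ℕ} (hl : l < k t)
    (j : Σ t, Fin (2 * k t + 1)) :
    blockDiagonal' (fun t => kroneckerSnd (k t)) ⟨t, ⟨2 * (l + 1), by omega⟩⟩ j =
      if j = ⟨t, ⟨2 * l + 1, by omega⟩⟩ then -1 else 0 := by
  obtain ⟨s, j, hj⟩ := j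
  rcases eq_or_ne t s with rfl | hts
  · rw [blockDiagonal'_apply_eq]
    simp only [kroneckerSnd, Nat.odd_iff, Sigma.mk.injEq, heq_eq_eq, true_and, Fin.mk.injEq]
    split_ifs <;> first | rfl | omega
  · rw [blockDiagonal'_apply_ne _ _ _ hts, if_neg fun h => hts (congrArg Sigma.fst h).symm]

theorem blockDiagonal_kroneckerSnd_odd {t : T} {l : ℕ} (hl : l < k t)
    (j : Σ t, Fin (2 * k t + 1)) :
    blockDiagonal' (fun t => kroneckerSnd (k t)) ⟨t, ⟨2 * l + 1, by omega⟩⟩ j =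
      if j = ⟨t, ⟨2 * (l + 1), by omega⟩⟩ then 1 else 0 := by
  obtain ⟨s, j, hj⟩ := j
  rcases eq_or_ne t s with rfl | hts
  · rw [blockDiagonal'_apply_eq]
    simp only [kroneckerSnd, Nat.odd_iff, Sigma.mk.injEq, heq_eq_eq, true_and, Fin.mk.injEq]
    split_ifs <;> first | rfl | omega
  · rw [blockDiagonal'_apply_ne _ _ _ hts, if_neg fun h => hts (congrArg Sigma.fst h).symm]

end Rows

/-! ### Frames as bases of their blocks, with an orthogonal complement -/

namespace KroneckerFrame

variable {W : Type*} [AddCommGroup W] [Module ℂ W] {B₁ B₂ : LinearMap.BilinForm ℂ W}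
  {T : Type*} {k : T → ℕ}

/-- The vectors of a Kronecker frame in the order of the standard bases of its blocks. -/
def vec (F : KroneckerFrame B₁ B₂ T k) (i : Σ t, Fin (2 * k t + 1)) : W :=
  if (i.2 : ℕ) % 2 = 0 then F.even i.1 (i.2 / 2) else F.odd i.1 (i.2 / 2)

/-- The functionals dual to the vectors `vec`. -/
def coord (F : KroneckerFrame B₁ B₂ T k) (i : Σ t, Fin (2 * k t + 1)) : Module.Dual ℂ W :=
  if (i.2 : ℕ) % 2 = 0 then F.evenCoord i.1 (i.2 / 2) else F.oddCoord i.1 (i.2 / 2)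

variable (F : KroneckerFrame B₁ B₂ T k)

theorem vec_even (t : T) (l : ℕ) (h : 2 * l < 2 * k t + 1) :
    F.vec ⟨t, ⟨2 * l, h⟩⟩ = F.even t l := by
  simp [vec]

theorem vec_odd (t : T) (l : ℕ) (h : 2 * l + 1 < 2 * k t + 1) :
    F.vec ⟨t, ⟨2 * l + 1, h⟩⟩ = F.odd t l := by
  simp [vec, Nat.mul_add_div]

theorem coord_even (t : T) (l : ℕ) (h : 2 * l < 2 * k t + 1) :
    F.coord ⟨t, ⟨2 * l, h⟩⟩ = F.evenCoord t l := by
  simp [coord]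

theorem coord_odd (t : T) (l : ℕ) (h : 2 * l + 1 < 2 * k t + 1) :
    F.coord ⟨t, ⟨2 * l + 1, h⟩⟩ = F.oddCoord t l := by
  simp [coord, Nat.mul_add_div]

theorem index_cases {p : (Σ t, Fin (2 * k t + 1)) → Prop}
    (heven : ∀ t l (h : 2 * l < 2 * k t + 1), l ≤ k t → p ⟨t, ⟨2 * l, h⟩⟩)
    (hodd : ∀ t l (h : 2 * l + 1 < 2 * k t + 1), l < k t → p ⟨t, ⟨2 * l + 1, h⟩⟩) (i) : p i := by
  obtain ⟨t, i, hi⟩ := i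
  obtain ⟨l, rfl | rfl⟩ := Nat.even_or_odd' i
  · exact heven t l hi (by omega)
  · exact hodd t l hi (by omega)

theorem coord_vec [DecidableEq T] (i j : Σ t, Fin (2 * k t + 1)) :
    F.coord i (F.vec j) = if i = j then 1 else 0 := by
  revert i j
  refine index_cases (fun s i hi hi' => index_cases (fun t j hj hj' => ?_) (fun t j hj hj' => ?_))
    (fun s i hi hi' => index_cases (fun t j hj hj' => ?_) (fun t j hj hj' => ?_))
  · rw [coord_even, vec_even]
    split_ifs with h
    · have h' := h
      rw [Sigma.mk.injEq] at h'
      obtain ⟨rfl, h'⟩ := h'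
      have := congrArg Fin.val (eq_of_heq h')
      exact F.evenCoord_even _ _ _ _ hi' hj' rfl (by simpa using this)
    · refine F.evenCoord_even_ne _ _ _ _ hi' hj' ?_
      by_contra! hcon
      obtain ⟨rfl, rfl⟩ := hcon
      exact h rfl
  · rw [coord_even, vec_odd, F.evenCoord_odd _ _ _ _ hi' hj', if_neg]
    intro h
    rw [Sigma.mk.injEq] at h
    obtain ⟨rfl, h'⟩ := h
    have := congrArg Fin.val (eq_of_heq h')
    simp only at this
    omega
  · rw [coord_odd, vec_even, F.oddCoord_even _ _ _ _ hi' hj', if_neg]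
    intro h
    rw [Sigma.mk.injEq] at h
    obtain ⟨rfl, h'⟩ := h
    have := congrArg Fin.val (eq_of_heq h')
    simp only at this
    omega
  · rw [coord_odd, vec_odd]
    split_ifs with h
    · have h' := h
      rw [Sigma.mk.injEq] at h'
      obtain ⟨rfl, h'⟩ := h'
      have := congrArg Fin.val (eq_of_heq h')
      exact F.oddCoord_odd _ _ _ _ hi' hj' rfl (by simpa using this)
    · refine F.oddCoord_odd_ne _ _ _ _ hi' hj' ?_
      by_contra! hcon
      obtain ⟨rfl, rfl⟩ := hcon
      exact h rfl

theorem gram [DecidableEq T] (i j : Σ t, Fin (2 * k t + 1)) :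
    B₁ (F.vec i) (F.vec j) = Matrix.blockDiagonal' (fun t => kroneckerFst (k t)) i j ∧
    B₂ (F.vec i) (F.vec j) = Matrix.blockDiagonal' (fun t => kroneckerSnd (k t)) i j := by
  revert i
  refine index_cases (fun t l h hl => ⟨?_, ?_⟩) (fun t l h hl => ⟨?_, ?_⟩)
  · rcases hl.lt_or_eq with hl | rfl
    · rw [blockDiagonal_kroneckerFst_even hl, vec_even, F.fst_even _ _ _ hl,
        ← F.coord_odd t l (by omega), coord_vec]
      exact if_congr eq_comm rfl rfl
    · rw [blockDiagonal_kroneckerFst_last, vec_even, F.fst_last]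
  · cases l with
    | zero => rw [blockDiagonal_kroneckerSnd_zero, vec_even, F.snd_zero]
    | succ l =>
      rw [blockDiagonal_kroneckerSnd_even hl, vec_even, F.snd_even _ _ _ hl,
        ← F.coord_odd t l (by omega), coord_vec, neg_eq_iff_eq_neg]
      simp only [neg_ite, neg_neg, neg_zero]
      exact if_congr eq_comm rfl rfl
  · rw [blockDiagonal_kroneckerFst_odd hl, vec_odd, F.fst_odd _ _ _ hl,
      ← F.coord_even t l (by omega), coord_vec, neg_eq_iff_eq_neg]
    simp only [neg_ite, neg_neg, neg_zero]
    exact if_congr eq_comm rfl rfl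
  · rw [blockDiagonal_kroneckerSnd_odd hl, vec_odd, F.snd_odd _ _ _ hl,
      ← F.coord_even t (l + 1) (by omega), coord_vec]
    exact if_congr eq_comm rfl rfl

/-- The complement of the blocks of a Kronecker frame. -/
def compl : Submodule ℂ W := ⨅ i, LinearMap.ker (F.coord i)

theorem mem_compl {x : W} : x ∈ F.compl ↔ ∀ i, F.coord i x = 0 := by
  simp [compl]

theorem mem_compl' {x : W} : x ∈ F.compl ↔
    (∀ t, ∀ l ≤ k t, F.evenCoord t l x = 0) ∧ ∀ t, ∀ l < k t, F.oddCoord t l x = 0 := by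
  rw [mem_compl]
  refine ⟨fun h => ⟨fun t l hl => ?_, fun t l hl => ?_⟩, fun h => ?_⟩
  · rw [← F.coord_even t l (by omega)]
    exact h _
  · rw [← F.coord_odd t l (by omega)]
    exact h _
  · refine index_cases (fun t l hl hl' => ?_) (fun t l hl hl' => ?_)
    · rw [coord_even]
      exact h.1 t l hl'
    · rw [coord_odd]
      exact h.2 t l hl'

theorem apply_vec_of_mem_compl (i) {y : W} (hy : y ∈ F.compl) :
    B₁ (F.vec i) y = 0 ∧ B₂ (F.vec i) y = 0 := by
  rw [mem_compl'] at hy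
  revert i
  refine index_cases (fun t l h hl => ⟨?_, ?_⟩) (fun t l h hl => ⟨?_, ?_⟩)
  · rw [vec_even]
    rcases hl.lt_or_eq with hl | rfl
    · rw [F.fst_even _ _ _ hl, hy.2 t l hl]
    · rw [F.fst_last]
  · rw [vec_even]
    cases l with
    | zero => rw [F.snd_zero]
    | succ l => rw [F.snd_even _ _ _ hl, hy.2 t l hl, neg_zero]
  · rw [vec_odd, F.fst_odd _ _ _ hl, hy.1 t l hl.le, neg_zero]
  · rw [vec_odd, F.snd_odd _ _ _ hl, hy.1 t _ hl]

variable [Fintype T]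

/-- The projection to the complement of the blocks. -/
def proj : W →ₗ[ℂ] W := LinearMap.id - ∑ i, (F.coord i).smulRight (F.vec i)

theorem proj_apply (x : W) : F.proj x = x - ∑ i, F.coord i x • F.vec i := by
  simp [proj]

theorem coord_sum [DecidableEq T] (c : (Σ t, Fin (2 * k t + 1)) → ℂ) (i) :
    F.coord i (∑ j, c j • F.vec j) = c i := by
  simp [coord_vec]

theorem proj_mem (x : W) : F.proj x ∈ F.compl := by
  classical
  rw [mem_compl]
  intro i
  rw [proj_apply, map_sub, coord_sum, sub_self]

theorem proj_eq_self {x : W} (hx : x ∈ F.compl) : F.proj x = x := by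
  rw [proj_apply, Finset.sum_eq_zero, sub_zero]
  intro i _
  rw [F.mem_compl.1 hx i, zero_smul]

theorem proj_vec (i) : F.proj (F.vec i) = 0 := by
  classical
  simp [proj_apply, coord_vec]

theorem eq_sum_add_proj (x : W) : x = ∑ i, F.coord i x • F.vec i + F.proj x := by
  rw [proj_apply, add_sub_cancel]

/-- The difference `y - F.proj y` lies in the blocks, which are orthogonal to the complement. -/
theorem apply_proj_right {x : W} (hx : x ∈ F.compl) (h₁ : ∀ x y, B₁ x y = - B₁ y x)
    (h₂ : ∀ x y, B₂ x y = - B₂ y x) (y : W) :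
    B₁ x y = B₁ x (F.proj y) ∧ B₂ x y = B₂ x (F.proj y) := by
  have e := F.eq_sum_add_proj y
  constructor
  · conv_lhs => rw [e]
    rw [map_add, map_sum, Finset.sum_eq_zero, zero_add]
    intro i _
    rw [map_smul, h₁, (F.apply_vec_of_mem_compl i hx).1, neg_zero, smul_zero]
  · conv_lhs => rw [e]
    rw [map_add, map_sum, Finset.sum_eq_zero, zero_add]
    intro i _
    rw [map_smul, h₂, (F.apply_vec_of_mem_compl i hx).2, neg_zero, smul_zero]

theorem linearIndependent_vec : LinearIndependent ℂ F.vec := by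
  classical
  rw [Fintype.linearIndependent_iff]
  intro g hg i
  rw [← F.coord_sum g i, hg, map_zero]

theorem isCompl : IsCompl (Submodule.span ℂ (Set.range F.vec)) F.compl := by
  classical
  constructor
  · rw [Submodule.disjoint_def]
    intro x hx hx'
    obtain ⟨c, rfl⟩ := (Submodule.mem_span_range_iff_exists_fun ℂ).1 hx
    refine Finset.sum_eq_zero fun i _ => ?_
    rw [← F.coord_sum c i, F.mem_compl.1 hx' i, zero_smul]
  · rw [codisjoint_iff, eq_top_iff]
    intro x _
    rw [F.eq_sum_add_proj x]
    exact Submodule.add_mem_sup (Submodule.sum_mem _ fun i _ =>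
      Submodule.smul_mem _ _ (Submodule.subset_span ⟨i, rfl⟩)) (F.proj_mem x)

theorem finrank_eq [FiniteDimensional ℂ W] :
    Module.finrank ℂ W = ∑ t, (2 * k t + 1) + Module.finrank ℂ F.compl := by
  rw [← Submodule.finrank_add_eq_of_isCompl F.isCompl,
    finrank_span_eq_card F.linearIndependent_vec]
  simp

theorem splitsKroneckerBlocks {r : ℕ} {k : Fin r → ℕ} (F : KroneckerFrame B₁ B₂ (Fin r) k) :
    SplitsKroneckerBlocks B₁ B₂ r := by
  refine ⟨_, _, F.isCompl, ?_, k, Module.Basis.span F.linearIndependent_vec, fun i j => ?_⟩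
  · intro x hx y hy
    obtain ⟨c, rfl⟩ := (Submodule.mem_span_range_iff_exists_fun ℂ).1 hx
    simp [(F.apply_vec_of_mem_compl _ hy).1, (F.apply_vec_of_mem_compl _ hy).2]
  · simpa [Module.Basis.span_apply] using F.gram i j

theorem isKroneckerSum {r : ℕ} {k : Fin r → ℕ} (F : KroneckerFrame B₁ B₂ (Fin r) k)
    (hF : F.compl = ⊥) : IsKroneckerSum B₁ B₂ k := by
  have htop : Submodule.span ℂ (Set.range F.vec) = ⊤ := by
    simpa [hF] using F.isCompl.sup_eq_top
  refine ⟨Module.Basis.mk F.linearIndependent_vec htop.ge, fun i j => ?_⟩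
  simpa using F.gram i j

/-- Reindexing of the blocks. -/
def reindex {S : Type*} (σ : S ≃ T) : KroneckerFrame B₁ B₂ S (k ∘ σ) where
  even s := F.even (σ s)
  odd s := F.odd (σ s)
  evenCoord s := F.evenCoord (σ s)
  oddCoord s := F.oddCoord (σ s)
  evenCoord_even _ _ i j hi hj hst := F.evenCoord_even _ _ i j hi hj (congrArg σ hst)
  evenCoord_even_ne _ _ i j hi hj h := F.evenCoord_even_ne _ _ i j hi hj
    (h.imp_left σ.injective.ne)
  evenCoord_odd _ _ i j := F.evenCoord_odd _ _ i j
  oddCoord_even _ _ i j := F.oddCoord_even _ _ i j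
  oddCoord_odd _ _ i j hi hj hst := F.oddCoord_odd _ _ i j hi hj (congrArg σ hst)
  oddCoord_odd_ne _ _ i j hi hj h := F.oddCoord_odd_ne _ _ i j hi hj
    (h.imp_left σ.injective.ne)
  fst_even _ := F.fst_even _
  fst_last _ := F.fst_last _
  fst_odd _ := F.fst_odd _
  snd_zero _ := F.snd_zero _
  snd_even _ := F.snd_even _
  snd_odd _ := F.snd_odd _

end KroneckerFrame

namespace KroneckerFrame

variable {W : Type*} [AddCommGroup W] [Module ℂ W] {B₁ B₂ : LinearMap.BilinForm ℂ W}

/-- The Kronecker frame given by dual families of vectors and functionals in the order of the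
standard bases of the blocks. -/
def ofDual {T : Type*} [DecidableEq T] {k : T → ℕ}
    (w : (Σ t, Fin (2 * k t + 1)) → W) (φ : (Σ t, Fin (2 * k t + 1)) → Module.Dual ℂ W)
    (hφ : ∀ i j, φ i (w j) = if i = j then 1 else 0) [Fintype T]
    (h₁ : ∀ i y, B₁ (w i) y =
      ∑ j, Matrix.blockDiagonal' (fun t => kroneckerFst (k t)) i j * φ j y)
    (h₂ : ∀ i y, B₂ (w i) y =
      ∑ j, Matrix.blockDiagonal' (fun t => kroneckerSnd (k t)) i j * φ j y) :
    KroneckerFrame B₁ B₂ T k where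
  even t l := if h : 2 * l < 2 * k t + 1 then w ⟨t, ⟨2 * l, h⟩⟩ else 0
  odd t l := if h : 2 * l + 1 < 2 * k t + 1 then w ⟨t, ⟨2 * l + 1, h⟩⟩ else 0
  evenCoord t l := if h : 2 * l < 2 * k t + 1 then φ ⟨t, ⟨2 * l, h⟩⟩ else 0
  oddCoord t l := if h : 2 * l + 1 < 2 * k t + 1 then φ ⟨t, ⟨2 * l + 1, h⟩⟩ else 0
  evenCoord_even s t i j hi hj hst hij := by
    subst hst hij
    rw [dif_pos (by omega), dif_pos (by omega), hφ, if_pos rfl]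
  evenCoord_even_ne s t i j hi hj h := by
    rw [dif_pos (by omega), dif_pos (by omega), hφ, if_neg]
    rcases eq_or_ne s t with rfl | hst
    · simp only [Sigma.mk.injEq, heq_eq_eq, true_and, Fin.mk.injEq]
      have : i ≠ j := by simpa using h
      omega
    · exact fun e => hst (congrArg Sigma.fst e)
  evenCoord_odd s t i j hi hj := by
    rw [dif_pos (by omega), dif_pos (by omega), hφ, if_neg]
    rcases eq_or_ne s t with rfl | hst
    · simp only [Sigma.mk.injEq, heq_eq_eq, true_and, Fin.mk.injEq]
      omega
    · exact fun e => hst (congrArg Sigma.fst e)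
  oddCoord_even s t i j hi hj := by
    rw [dif_pos (by omega), dif_pos (by omega), hφ, if_neg]
    rcases eq_or_ne s t with rfl | hst
    · simp only [Sigma.mk.injEq, heq_eq_eq, true_and, Fin.mk.injEq]
      omega
    · exact fun e => hst (congrArg Sigma.fst e)
  oddCoord_odd s t i j hi hj hst hij := by
    subst hst hij
    rw [dif_pos (by omega), dif_pos (by omega), hφ, if_pos rfl]
  oddCoord_odd_ne s t i j hi hj h := by
    rw [dif_pos (by omega), dif_pos (by omega), hφ, if_neg]
    rcases eq_or_ne s t with rfl | hst
    · simp only [Sigma.mk.injEq, heq_eq_eq, true_and, Fin.mk.injEq]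
      have : i ≠ j := by simpa using h
      omega
    · exact fun e => hst (congrArg Sigma.fst e)
  fst_even t l y hl := by
    rw [dif_pos (by omega), dif_pos (by omega), h₁]
    simp [blockDiagonal_kroneckerFst_even hl]
  fst_last t y := by
    rw [dif_pos (by omega), h₁]
    simp [blockDiagonal_kroneckerFst_last]
  fst_odd t l y hl := by
    rw [dif_pos (by omega), dif_pos (by omega), h₁]
    simp [blockDiagonal_kroneckerFst_odd hl]
  snd_zero t y := by
    rw [dif_pos (by omega), h₂]
    simp only [blockDiagonal_kroneckerSnd_zero, zero_mul, Finset.sum_const_zero]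
  snd_even t l y hl := by
    rw [dif_pos (by omega), dif_pos (by omega), h₂]
    simp [blockDiagonal_kroneckerSnd_even hl]
  snd_odd t l y hl := by
    rw [dif_pos (by omega), dif_pos (by omega), h₂]
    simp [blockDiagonal_kroneckerSnd_odd hl]

end KroneckerFrame

/-! ### Decompositions with the maximal number of blocks -/

section Splitting

variable {W : Type*} [AddCommGroup W] [Module ℂ W] {B₁ B₂ : LinearMap.BilinForm ℂ W}

/-- The dual functionals are the coordinates on `P` composed with the projection along `Q`.
Orthogonality of `Q` extends the Gram relations from `P` to pairings with arbitrary vectors. -/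
theorem SplitsKroneckerBlocks.exists_frame {r : ℕ} (h : SplitsKroneckerBlocks B₁ B₂ r) :
    ∃ k : Fin r → ℕ, Nonempty (KroneckerFrame B₁ B₂ (Fin r) k) := by
  obtain ⟨P, Q, hPQ, horth, k, b, hb⟩ := h
  have hexp : ∀ (B : LinearMap.BilinForm ℂ W), (∀ x ∈ P, ∀ y ∈ Q, B x y = 0) → ∀ i y,
      B (b i : W) y = ∑ j, B.restrict P (b i) (b j) * b.coord j (P.projectionOnto Q hPQ y) := by
    intro B hB i y
    have hy : y = (P.projectionOnto Q hPQ y : W) + (Q.projectionOnto P hPQ.symm y : W) := by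
      simp [Submodule.projection_add_projection_eq_self]
    conv_lhs => rw [hy]
    rw [map_add, hB _ (b i).2 _ (Submodule.coe_mem _), add_zero]
    have := congrArg (fun x => B.restrict P (b i) x) (b.sum_repr (P.projectionOnto Q hPQ y))
    simp only [map_sum, map_smul, smul_eq_mul] at this
    calc _ = B.restrict P (b i) (P.projectionOnto Q hPQ y) := rfl
      _ = _ := by
        rw [← this]
        exact Finset.sum_congr rfl fun j _ => mul_comm _ _
  refine ⟨k, ⟨KroneckerFrame.ofDual (fun i => (b i : W))
    (fun i => (b.coord i).comp (P.projectionOnto Q hPQ)) ?_ ?_ ?_⟩⟩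
  · intro i j
    simp [Finsupp.single_apply, eq_comm]
  · intro i y
    rw [hexp B₁ (fun x hx y hy => (horth x hx y hy).1)]
    exact Finset.sum_congr rfl fun j _ => by rw [(hb i j).1]; rfl
  · intro i y
    rw [hexp B₂ (fun x hx y hy => (horth x hx y hy).2)]
    exact Finset.sum_congr rfl fun j _ => by rw [(hb i j).2]; rfl

namespace KroneckerFrame

/-- The projection to the complement of the blocks, as a map to the complement. -/
def projCompl {T : Type*} [Fintype T] {k : T → ℕ} (F : KroneckerFrame B₁ B₂ T k) :
    W →ₗ[ℂ] F.compl :=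
  F.proj.codRestrict F.compl F.proj_mem

theorem projCompl_coe {T : Type*} [Fintype T] {k : T → ℕ} (F : KroneckerFrame B₁ B₂ T k)
    (x : F.compl) : F.projCompl x = x :=
  Subtype.ext (F.proj_eq_self x.2)

theorem projCompl_even {T : Type*} [Fintype T] {k : T → ℕ} (F : KroneckerFrame B₁ B₂ T k)
    {t : T} {l : ℕ} (hl : l ≤ k t) : F.projCompl (F.even t l) = 0 := by
  rw [← F.vec_even t l (by omega)]
  exact Subtype.ext (F.proj_vec _)

theorem projCompl_odd {T : Type*} [Fintype T] {k : T → ℕ} (F : KroneckerFrame B₁ B₂ T k)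
    {t : T} {l : ℕ} (hl : l < k t) : F.projCompl (F.odd t l) = 0 := by
  rw [← F.vec_odd t l (by omega)]
  exact Subtype.ext (F.proj_vec _)

/-- A Kronecker frame with a block of its complement added. -/
def addBlock {T : Type*} [Fintype T] {k : T → ℕ} (F : KroneckerFrame B₁ B₂ T k)
    (h₁ : ∀ x y, B₁ x y = - B₁ y x) (h₂ : ∀ x y, B₂ x y = - B₂ y x) {d : ℕ}
    (G : KroneckerFrame (B₁.restrict F.compl) (B₂.restrict F.compl) Unit fun _ => d) :
    KroneckerFrame B₁ B₂ (Option T) fun o => o.elim d k where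
  even o l := o.elim (G.even () l : W) fun t => F.even t l
  odd o l := o.elim (G.odd () l : W) fun t => F.odd t l
  -- Functionals on the complement are extended to `W` by zero on the old blocks.
  evenCoord o l := o.elim ((G.evenCoord () l).comp F.projCompl) fun t => F.evenCoord t l
  oddCoord o l := o.elim ((G.oddCoord () l).comp F.projCompl) fun t => F.oddCoord t l
  evenCoord_even s t i j hi hj hst hij := by
    subst hst
    rcases s with _ | s
    · simpa [projCompl_coe] using G.evenCoord_even () () i j hi hj rfl hij
    · exact F.evenCoord_even _ _ i j hi hj rfl hij
  evenCoord_even_ne s t i j hi hj h := by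
    rcases s with _ | s <;> rcases t with _ | t
    · simpa [projCompl_coe] using G.evenCoord_even_ne () () i j hi hj (by simpa using h)
    · simp [F.projCompl_even hj]
    · exact (F.mem_compl'.1 (G.even () j).2).1 s i hi
    · exact F.evenCoord_even_ne _ _ i j hi hj (by simpa using h)
  evenCoord_odd s t i j hi hj := by
    rcases s with _ | s <;> rcases t with _ | t
    · simpa [projCompl_coe] using G.evenCoord_odd () () i j hi hj
    · simp [F.projCompl_odd hj]
    · exact (F.mem_compl'.1 (G.odd () j).2).1 s i hi
    · exact F.evenCoord_odd _ _ i j hi hj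
  oddCoord_even s t i j hi hj := by
    rcases s with _ | s <;> rcases t with _ | t
    · simpa [projCompl_coe] using G.oddCoord_even () () i j hi hj
    · simp [F.projCompl_even hj]
    · exact (F.mem_compl'.1 (G.even () j).2).2 s i hi
    · exact F.oddCoord_even _ _ i j hi hj
  oddCoord_odd s t i j hi hj hst hij := by
    subst hst
    rcases s with _ | s
    · simpa [projCompl_coe] using G.oddCoord_odd () () i j hi hj rfl hij
    · exact F.oddCoord_odd _ _ i j hi hj rfl hij
  oddCoord_odd_ne s t i j hi hj h := by
    rcases s with _ | s <;> rcases t with _ | t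
    · simpa [projCompl_coe] using G.oddCoord_odd_ne () () i j hi hj (by simpa using h)
    · simp [F.projCompl_odd hj]
    · exact (F.mem_compl'.1 (G.odd () j).2).2 s i hi
    · exact F.oddCoord_odd_ne _ _ i j hi hj (by simpa using h)
  fst_even t l y hl := by
    rcases t with _ | t
    · exact (F.apply_proj_right (G.even () l).2 h₁ h₂ y).1.trans
        (G.fst_even () l (F.projCompl y) hl)
    · exact F.fst_even t l y hl
  fst_last t y := by
    rcases t with _ | t
    · exact (F.apply_proj_right (G.even () _).2 h₁ h₂ y).1.trans (G.fst_last () (F.projCompl y))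
    · exact F.fst_last t y
  fst_odd t l y hl := by
    rcases t with _ | t
    · exact (F.apply_proj_right (G.odd () l).2 h₁ h₂ y).1.trans
        (G.fst_odd () l (F.projCompl y) hl)
    · exact F.fst_odd t l y hl
  snd_zero t y := by
    rcases t with _ | t
    · exact (F.apply_proj_right (G.even () _).2 h₁ h₂ y).2.trans (G.snd_zero () (F.projCompl y))
    · exact F.snd_zero t y
  snd_even t l y hl := by
    rcases t with _ | t
    · exact (F.apply_proj_right (G.even () _).2 h₁ h₂ y).2.trans
        (G.snd_even () l (F.projCompl y) hl)
    · exact F.snd_even t l y hl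
  snd_odd t l y hl := by
    rcases t with _ | t
    · exact (F.apply_proj_right (G.odd () l).2 h₁ h₂ y).2.trans
        (G.snd_odd () l (F.projCompl y) hl)
    · exact F.snd_odd t l y hl

/-- Some pairing of the pencil is nondegenerate on the complement of the blocks. -/
def IsMaximal {T : Type*} {k : T → ℕ} (F : KroneckerFrame B₁ B₂ T k) : Prop :=
  ∃ c : ℂ, ∀ x : F.compl, (∀ y : F.compl, B₁ x y + c * B₂ x y = 0) → x = 0

end KroneckerFrame

theorem SplitsKroneckerBlocks.le_finrank [FiniteDimensional ℂ W] {r : ℕ}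
    (h : SplitsKroneckerBlocks B₁ B₂ r) : r ≤ Module.finrank ℂ W := by
  obtain ⟨k, ⟨F⟩⟩ := h.exists_frame
  have h1 : ∑ _ : Fin r, 1 ≤ ∑ t, (2 * k t + 1) := Finset.sum_le_sum fun t _ => by omega
  have h2 : ∑ _ : Fin r, 1 = r := by simp
  have := F.finrank_eq
  omega

theorem SplitsKroneckerBlocks.le_numKroneckerBlocks [FiniteDimensional ℂ W] {r : ℕ}
    (h : SplitsKroneckerBlocks B₁ B₂ r) : r ≤ numKroneckerBlocks B₁ B₂ :=
  le_csSup ⟨_, fun _ hr => hr.le_finrank⟩ h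

theorem splitsKroneckerBlocks_zero : SplitsKroneckerBlocks B₁ B₂ 0 := by
  refine ⟨⊥, ⊤, isCompl_bot_top, ?_, Fin.elim0, Module.Basis.empty _, fun i => i.1.elim0⟩
  intro x hx y _
  simp [(Submodule.mem_bot ℂ).1 hx]

/-- There is a Kronecker frame with as many blocks as possible, and some pairing of the pencil is
nondegenerate on its complement. -/
theorem exists_maximal_frame [FiniteDimensional ℂ W]
    (h₁ : ∀ x y, B₁ x y = - B₁ y x) (h₂ : ∀ x y, B₂ x y = - B₂ y x) :
    ∃ (k : Fin (numKroneckerBlocks B₁ B₂) → ℕ)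
      (F : KroneckerFrame B₁ B₂ (Fin (numKroneckerBlocks B₁ B₂)) k), F.IsMaximal := by
  have hmem : SplitsKroneckerBlocks B₁ B₂ (numKroneckerBlocks B₁ B₂) :=
    Nat.sSup_mem (s := {r | SplitsKroneckerBlocks B₁ B₂ r}) ⟨0, splitsKroneckerBlocks_zero⟩
      ⟨_, fun _ hr => SplitsKroneckerBlocks.le_finrank hr⟩
  obtain ⟨k, ⟨F⟩⟩ := hmem.exists_frame
  refine ⟨k, F, ?_⟩
  by_contra hcon
  simp only [KroneckerFrame.IsMaximal, not_exists, not_forall] at hcon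
  -- A pencil everywhere degenerate on the complement would yield one block more than the maximal
  -- number.
  obtain ⟨d, ⟨G⟩⟩ := exists_block_frame (B₁ := B₁.restrict F.compl) (B₂ := B₂.restrict F.compl)
    (fun x y => h₁ x y) (fun x y => h₂ x y) fun c => by
      obtain ⟨x, hx, hx0⟩ := hcon c
      exact ⟨x, hx0, hx⟩
  have := ((F.addBlock h₁ h₂ G).reindex (finSuccEquiv _)).splitsKroneckerBlocks
    |>.le_numKroneckerBlocks
  omega

end Splitting

/-! ### Long Lenard chains lie in the span of the even vectors -/

section Chains

variable {W : Type*} [AddCommGroup W] [Module ℂ W] [FiniteDimensional ℂ W]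
  {B₁ B₂ : LinearMap.BilinForm ℂ W}

open Polynomial in
/-- Long Lenard chains of a nondegenerate pencil vanish. -/
theorem chain_eq_zero {c : ℂ} (hc : ∀ x, (∀ y, B₁ x y + c * B₂ x y = 0) → x = 0)
    {q : ℕ → W} {D : ℕ} (h0 : B₁ (q 0) = 0) (hs : ∀ i < D, B₁ (q (i + 1)) = - B₂ (q i)) {i : ℕ}
    (hi : i + Module.finrank ℂ W ≤ D) : q i = 0 := by
  let L : W →ₗ[ℂ] Module.Dual ℂ W := B₁ + c • B₂
  have hL : Function.Injective L := by
    rw [← LinearMap.ker_eq_bot, LinearMap.ker_eq_bot']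
    intro x hx
    exact hc x fun y => by simpa [L] using DFunLike.congr_fun hx y
  let e : W ≃ₗ[ℂ] Module.Dual ℂ W :=
    LinearEquiv.ofInjectiveOfFinrankEq L hL Subspace.dual_finrank_eq.symm
  have he : ∀ x, e x = B₁ x + c • B₂ x := fun x => rfl
  -- With `L = B₁ + c B₂` invertible, `T = L⁻¹ B₂` and `N = L⁻¹ B₁ = 1 - c T` commute, and the chain
  -- becomes `N qᵢ₊₁ = -T qᵢ` with `N q₀ = 0`.
  let T : Module.End ℂ W := LinearMap.comp e.symm.toLinearMap B₂
  have hT : ∀ x, T x = e.symm (B₂ x) := fun x => rfl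
  let N : Module.End ℂ W := 1 - c • T
  have hN : ∀ x, N x = e.symm (B₁ x) := by
    intro x
    have hx : B₁ x = e x - c • B₂ x := by rw [he, add_sub_cancel_right]
    rw [hx, map_sub, map_smul, LinearEquiv.symm_apply_apply]
    rfl
  have hcomm : Commute T N := by
    simp only [N]
    exact (Commute.one_right T).sub_right ((Commute.refl T).smul_right c)
  have hstep : ∀ i < D, N (q (i + 1)) = - T (q i) := by
    intro i hi
    rw [hN, hs i hi, hT, map_neg]
  -- The start of the chain puts all its members into the generalized kernel of `N`.
  have hnil : ∀ i ≤ D, (N ^ (i + 1)) (q i) = 0 := by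
    intro i
    induction i with
    | zero =>
      intro _
      simp [hN, h0]
    | succ i ih =>
      intro hi
      rw [pow_succ, Module.End.mul_apply, hstep i hi, map_neg, ← Module.End.mul_apply,
        ← (hcomm.pow_right (i + 1)).eq, Module.End.mul_apply, ih (by omega), map_zero, neg_zero]
  have hnil' : ∀ i ≤ D, (N ^ Module.finrank ℂ W) (q i) = 0 := by
    intro i hi
    exact LinearMap.mem_ker.1 (Module.End.ker_pow_le_ker_pow_finrank N (i + 1)
      (LinearMap.mem_ker.2 (hnil i hi)))
  have hshift : ∀ j i, i + j ≤ D → (N ^ j) (q (i + j)) = (-1 : ℂ) ^ j • (T ^ j) (q i) := by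
    intro j
    induction j with
    | zero => simp
    | succ j ih =>
      intro i hij
      rw [pow_succ', Module.End.mul_apply, show i + (j + 1) = i + 1 + j by omega,
        ih (i + 1) (by omega), map_smul, ← Module.End.mul_apply, ← (hcomm.pow_left j).eq,
        Module.End.mul_apply, hstep i (by omega), map_neg, ← Module.End.mul_apply, ← pow_succ,
        pow_succ (-1 : ℂ)]
      simp
  -- The continuation by `dim W` steps puts `q i` into the generalized kernel of `T`: up to sign,
  -- `Tⁿ qᵢ = Nⁿ qᵢ₊ₙ`, which vanishes.
  have hTq : (T ^ Module.finrank ℂ W) (q i) = 0 := by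
    have := hshift _ i hi
    rw [hnil' _ hi] at this
    exact (smul_eq_zero.1 this.symm).resolve_left (pow_ne_zero _ (by norm_num))
  -- The two generalized kernels meet in zero because `c X + (1 - c X) = 1`.
  have hcop : IsCoprime (X ^ Module.finrank ℂ W : ℂ[X]) ((1 - C c * X) ^ Module.finrank ℂ W) :=
    IsCoprime.pow ⟨C c, 1, by ring⟩
  refine (Submodule.disjoint_def.1 (Polynomial.disjoint_ker_aeval_of_isCoprime T hcop)) _ ?_ ?_
  · simpa using hTq
  · have : aeval T (1 - C c * X) = N := by
      simp [N, Algebra.smul_def]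
    rw [LinearMap.mem_ker, map_pow, this]
    exact hnil' i (by omega)

end Chains

namespace KroneckerFrame

variable {W : Type*} [AddCommGroup W] [Module ℂ W] {B₁ B₂ : LinearMap.BilinForm ℂ W}
  {T : Type*} {k : T → ℕ} (F : KroneckerFrame B₁ B₂ T k)

/-- The odd coordinate is the pairing `B₁` with an even vector. The two recurrences, of the chain
and of the block, lower `i` and `l` together until `B₁ (q 0) = 0` or `B₂ (even t 0) = 0` applies. -/
theorem oddCoord_chain (h₁ : ∀ x y, B₁ x y = - B₁ y x) (h₂ : ∀ x y, B₂ x y = - B₂ y x)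
    {q : ℕ → W} {D : ℕ} (h0 : B₁ (q 0) = 0) (hs : ∀ i < D, B₁ (q (i + 1)) = - B₂ (q i))
    {i : ℕ} (hi : i ≤ D) {t : T} {l : ℕ} (hl : l < k t) : F.oddCoord t l (q i) = 0 := by
  induction i generalizing l with
  | zero => rw [← F.fst_even t l _ hl, h₁, h0, LinearMap.zero_apply, neg_zero]
  | succ i ih =>
    rw [← F.fst_even t l _ hl, h₁, hs i hi, LinearMap.neg_apply, neg_neg, h₂, neg_eq_zero]
    cases l with
    | zero => exact F.snd_zero t _
    | succ l => rw [F.snd_even t l _ (by omega), ih (by omega) (by omega), neg_zero]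

/-- Since the blocks are orthogonal to the complement, projection maps chains of `W` to chains of
the complement, where `chain_eq_zero` applies. -/
theorem proj_chain_eq_zero [Fintype T] [FiniteDimensional ℂ W] (hF : F.IsMaximal)
    (h₁ : ∀ x y, B₁ x y = - B₁ y x) (h₂ : ∀ x y, B₂ x y = - B₂ y x)
    {q : ℕ → W} {D : ℕ} (h0 : B₁ (q 0) = 0) (hs : ∀ i < D, B₁ (q (i + 1)) = - B₂ (q i))
    {i : ℕ} (hi : i + Module.finrank ℂ W ≤ D) : F.proj (q i) = 0 := by
  obtain ⟨c, hc⟩ := hF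
  have hleft : ∀ (x : W) (y : F.compl), B₁ (F.proj x) y = B₁ x y ∧ B₂ (F.proj x) y = B₂ x y := by
    intro x y
    rw [h₁, ← (F.apply_proj_right y.2 h₁ h₂ x).1, h₂, ← (F.apply_proj_right y.2 h₁ h₂ x).2,
      ← h₁, ← h₂]
    exact ⟨rfl, rfl⟩
  have := chain_eq_zero (B₁ := B₁.restrict F.compl) (B₂ := B₂.restrict F.compl) (c := c)
    (q := fun i => F.projCompl (q i)) (D := D) (i := i) hc
    (by
      ext y
      exact (hleft _ y).1.trans (by simp [h0]))
    (fun i hi => by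
      ext y
      have := hs i hi
      exact (hleft _ y).1.trans ((DFunLike.congr_fun this (y : W)).trans
        (congrArg Neg.neg (hleft _ y).2.symm)))
    ((Nat.add_le_add_left (Submodule.finrank_le _) _).trans hi)
  exact congrArg Subtype.val this

theorem chain_mem_span [Fintype T] [FiniteDimensional ℂ W] (hF : F.IsMaximal)
    (h₁ : ∀ x y, B₁ x y = - B₁ y x) (h₂ : ∀ x y, B₂ x y = - B₂ y x)
    {q : ℕ → W} {D : ℕ} (h0 : B₁ (q 0) = 0) (hs : ∀ i < D, B₁ (q (i + 1)) = - B₂ (q i))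
    {i : ℕ} (hi : i + Module.finrank ℂ W ≤ D) :
    q i ∈ Submodule.span ℂ (Set.range fun p : Σ t, Fin (k t + 1) => F.even p.1 p.2) := by
  rw [F.eq_sum_add_proj (q i), F.proj_chain_eq_zero hF h₁ h₂ h0 hs hi, add_zero]
  refine Submodule.sum_mem _ fun j hj => ?_
  clear hj
  revert j
  refine index_cases (fun t l h hl => ?_) (fun t l h hl => ?_)
  · rw [vec_even]
    exact Submodule.smul_mem _ _ (Submodule.subset_span ⟨⟨t, ⟨l, by omega⟩⟩, rfl⟩)
  · rw [coord_odd, F.oddCoord_chain h₁ h₂ h0 hs (by omega) hl, zero_smul]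
    exact Submodule.zero_mem _

end KroneckerFrame

/-- A pair of skew-symmetric pairings with sufficiently many independent vectors in long Lenard
chains is a sum of Kronecker blocks. -/
theorem exists_frame_compl_eq_bot_of_chains {W : Type*} [AddCommGroup W] [Module ℂ W]
    [FiniteDimensional ℂ W] {B₁ B₂ : LinearMap.BilinForm ℂ W}
    (h₁ : ∀ x y, B₁ x y = - B₁ y x) (h₂ : ∀ x y, B₂ x y = - B₂ y x)
    {S : Type*} [Fintype S] {k₀ : S → ℕ} {q : S → ℕ → W} {D : ℕ}
    (hD : ∀ s, k₀ s + Module.finrank ℂ W ≤ D) (h0 : ∀ s, B₁ (q s 0) = 0)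
    (hs : ∀ s, ∀ i < D, B₁ (q s (i + 1)) = - B₂ (q s i))
    (hli : LinearIndependent ℂ fun p : Σ s, Fin (k₀ s + 1) => q p.1 p.2)
    (hcard : Module.finrank ℂ W + numKroneckerBlocks B₁ B₂ ≤ 2 * ∑ s, (k₀ s + 1)) :
    ∃ (k : Fin (numKroneckerBlocks B₁ B₂) → ℕ)
      (F : KroneckerFrame B₁ B₂ (Fin (numKroneckerBlocks B₁ B₂)) k), F.compl = ⊥ := by
  obtain ⟨k, F, hF⟩ := exists_maximal_frame h₁ h₂
  refine ⟨k, F, ?_⟩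
  have hle : ∑ s, (k₀ s + 1) ≤ ∑ t, (k t + 1) := by
    have h : Submodule.span ℂ (Set.range fun p : Σ s, Fin (k₀ s + 1) => q p.1 p.2) ≤
        Submodule.span ℂ (Set.range fun p : Σ t, Fin (k t + 1) => F.even p.1 p.2) := by
      rw [Submodule.span_le]
      rintro _ ⟨⟨s, i⟩, rfl⟩
      exact F.chain_mem_span (i := (i : ℕ)) hF h₁ h₂ (h0 s) (hs s) (by
        have := hD s
        have : (i : ℕ) < k₀ s + 1 := i.2
        omega)
    have := (Submodule.finrank_mono h).trans (finrank_range_le_card _)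
    rw [finrank_span_eq_card hli] at this
    simpa using this
  -- With `hcard` and `hle`, this identity bounds `dim W` by the total dimension of the blocks, so
  -- nothing is left for the complement.
  have hsum : ∑ t, (2 * k t + 1) + numKroneckerBlocks B₁ B₂ = 2 * ∑ t, (k t + 1) := by
    have h1 : ∑ _ : Fin (numKroneckerBlocks B₁ B₂), 1 = numKroneckerBlocks B₁ B₂ := by simp
    rw [Finset.mul_sum]
    conv_lhs => rhs; rw [← h1]
    rw [← Finset.sum_add_distrib]
    exact Finset.sum_congr rfl fun t _ => by ring
  have := F.finrank_eq
  exact Submodule.finrank_eq_zero.1 (by omega)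

/-! ### Dimension of the space of kernel polynomials of bounded degree -/

section KernelSequences

variable {W : Type*} [AddCommGroup W] [Module ℂ W]

/-- The coefficient sequences of the polynomials of degree less than `d` in the kernel of the
pencil `B₁ + λ B₂`. -/
def kernelSeq (B₁ B₂ : LinearMap.BilinForm ℂ W) (d : ℕ) : Submodule ℂ (ℕ → W) where
  carrier := {z | (∀ i ≥ d, z i = 0) ∧ B₁ (z 0) = 0 ∧ ∀ i, B₁ (z (i + 1)) = - B₂ (z i)}
  add_mem' := by
    rintro y z ⟨hy, hy0, hy1⟩ ⟨hz, hz0, hz1⟩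
    refine ⟨fun i hi => ?_, ?_, fun i => ?_⟩
    · rw [Pi.add_apply, hy i hi, hz i hi, add_zero]
    · rw [Pi.add_apply, map_add, hy0, hz0, add_zero]
    · rw [Pi.add_apply, Pi.add_apply, map_add, map_add, hy1, hz1, neg_add]
  zero_mem' := by simp
  smul_mem' := by
    rintro c z ⟨hz, hz0, hz1⟩
    refine ⟨fun i hi => ?_, ?_, fun i => ?_⟩
    · rw [Pi.smul_apply, hz i hi, smul_zero]
    · rw [Pi.smul_apply, map_smul, hz0, smul_zero]
    · rw [Pi.smul_apply, Pi.smul_apply, map_smul, map_smul, hz1, smul_neg]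

variable {B₁ B₂ : LinearMap.BilinForm ℂ W}

namespace KroneckerFrame

variable {T : Type*} {k : T → ℕ} (F : KroneckerFrame B₁ B₂ T k)

/-- The even coordinates of a chain form a Hankel array: they depend only on `t` and on the sum of
the two indices, because both are moved by pairing with an odd vector. -/
theorem evenCoord_shift (h₁ : ∀ x y, B₁ x y = - B₁ y x) (h₂ : ∀ x y, B₂ x y = - B₂ y x)
    {z : ℕ → W} (hz : ∀ i, B₁ (z (i + 1)) = - B₂ (z i)) (t : T) (i j l : ℕ) (hl : l + j ≤ k t) :
    F.evenCoord t l (z (i + j)) = F.evenCoord t (l + j) (z i) := by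
  induction j generalizing l with
  | zero => rfl
  | succ j ih =>
    rw [show l + (j + 1) = l + 1 + j by ring, ← ih (l + 1) (by omega),
      ← F.snd_odd t l _ (by omega), ← add_assoc, ← neg_neg (F.evenCoord t l _),
      ← F.fst_odd t l _ (by omega), h₁, hz, LinearMap.neg_apply, neg_neg, h₂, neg_neg]

/-- The coordinates that determine a kernel sequence. -/
def kernelSeqCoord (d : ℕ) : kernelSeq B₁ B₂ d →ₗ[ℂ] ((Σ t, Fin (d - k t)) → ℂ) :=
  LinearMap.pi fun p => (F.evenCoord p.1 (k p.1)).comp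
    ((LinearMap.proj (p.2 : ℕ)).comp (kernelSeq B₁ B₂ d).subtype)

variable [Fintype T]

/-- Only even coordinates survive, and in block `t` they depend on `s = l + i` alone. They vanish
for `s < k t` because `B₁ (z 0) = 0`, and for `s ≥ d` because `z s = 0`. The remaining values `k t ≤
s < d` are those recorded by `kernelSeqCoord`. The continuation needed by `proj_chain_eq_zero` is
free, as a kernel sequence goes on by zeros. -/
theorem kernelSeqCoord_injective [FiniteDimensional ℂ W] (hF : F.IsMaximal)
    (h₁ : ∀ x y, B₁ x y = - B₁ y x) (h₂ : ∀ x y, B₂ x y = - B₂ y x) (d : ℕ) :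
    Function.Injective (F.kernelSeqCoord d) := by
  rw [← LinearMap.ker_eq_bot, LinearMap.ker_eq_bot']
  rintro ⟨z, hz⟩ hc
  obtain ⟨hd, h0, hs⟩ := hz
  have hc' : ∀ t i, i < d - k t → F.evenCoord t (k t) (z i) = 0 :=
    fun t i hi => congrFun hc ⟨t, ⟨i, hi⟩⟩
  refine Subtype.ext (funext fun i => ?_)
  simp only [ZeroMemClass.coe_zero, Pi.zero_apply]
  rw [F.eq_sum_add_proj (z i), F.proj_chain_eq_zero hF h₁ h₂ h0 (fun i _ => hs i) le_rfl, add_zero]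
  refine Finset.sum_eq_zero fun j hj => ?_
  clear hj
  revert j
  refine index_cases (fun t l h hl => ?_) (fun t l h hl => ?_)
  · rw [coord_even]
    suffices F.evenCoord t l (z i) = 0 by rw [this, zero_smul]
    rcases lt_or_ge (l + i) (k t) with hlt | hge
    · have := F.evenCoord_shift h₁ h₂ hs t 0 i l hlt.le
      rw [zero_add] at this
      rw [this, ← neg_eq_zero, ← F.fst_odd t _ _ hlt, h₁, h0, LinearMap.zero_apply, neg_zero]
    · rcases lt_or_ge (i + l) d with hlt' | hge'
      · have := F.evenCoord_shift h₁ h₂ hs t (i - (k t - l)) (k t - l) l (by omega)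
        rw [show i - (k t - l) + (k t - l) = i by omega, show l + (k t - l) = k t by omega] at this
        rw [this]
        exact hc' t _ (by omega)
      · have := F.evenCoord_shift h₁ h₂ hs t i l 0 (by omega)
        rw [zero_add] at this
        rw [← this, hd _ hge', map_zero]
  · rw [coord_odd, F.oddCoord_chain h₁ h₂ h0 (D := i) (fun i _ => hs i) le_rfl hl, zero_smul]

theorem kernelSeqCoord_surjective (d : ℕ) : Function.Surjective (F.kernelSeqCoord d) := by
  classical
  intro c
  -- The prescribed Hankel values, zero outside `k t ≤ s < d`; the sequence `z` has `ε t (i + l)` as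
  -- its even coordinates.
  let ε : T → ℕ → ℂ := fun t s =>
    if h : k t ≤ s ∧ s < d then c ⟨t, ⟨s - k t, by omega⟩⟩ else 0
  let z : ℕ → W := fun i => ∑ t, ∑ l ∈ Finset.range (k t + 1), ε t (i + l) • F.even t l
  have hfst : ∀ i, B₁ (z i) =
      ∑ t, ∑ l ∈ Finset.range (k t), ε t (i + l) • F.oddCoord t l := by
    intro i
    simp only [z, map_sum, map_smul]
    refine Finset.sum_congr rfl fun t _ => ?_
    rw [Finset.sum_range_succ, show B₁ (F.even t (k t)) = 0 from LinearMap.ext (F.fst_last t),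
      smul_zero, add_zero]
    refine Finset.sum_congr rfl fun l hl => ?_
    rw [show B₁ (F.even t l) = F.oddCoord t l from
      LinearMap.ext fun y => F.fst_even t l y (Finset.mem_range.1 hl)]
  have hsnd : ∀ i, B₂ (z i) =
      - ∑ t, ∑ l ∈ Finset.range (k t), ε t (i + (l + 1)) • F.oddCoord t l := by
    intro i
    simp only [z, map_sum, map_smul]
    rw [← Finset.sum_neg_distrib]
    refine Finset.sum_congr rfl fun t _ => ?_
    rw [Finset.sum_range_succ', show B₂ (F.even t 0) = 0 from LinearMap.ext (F.snd_zero t),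
      smul_zero, add_zero, ← Finset.sum_neg_distrib]
    refine Finset.sum_congr rfl fun l hl => ?_
    rw [show B₂ (F.even t (l + 1)) = - F.oddCoord t l from
      LinearMap.ext fun y => F.snd_even t l y (Finset.mem_range.1 hl), smul_neg]
  refine ⟨⟨z, fun i hi => ?_, ?_, fun i => ?_⟩, ?_⟩
  · refine Finset.sum_eq_zero fun t _ => Finset.sum_eq_zero fun l _ => ?_
    rw [show ε t (i + l) = 0 from dif_neg (by omega), zero_smul]
  · rw [hfst]
    refine Finset.sum_eq_zero fun t _ => Finset.sum_eq_zero fun l hl => ?_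
    have := Finset.mem_range.1 hl
    rw [show ε t (0 + l) = 0 from dif_neg (by omega), zero_smul]
  · rw [hfst, hsnd, neg_neg]
    simp only [add_right_comm, ← add_assoc]
  · ext ⟨t, i, hi⟩
    change F.evenCoord t (k t) (z i) = _
    simp only [z, map_sum, map_smul, smul_eq_mul]
    rw [Finset.sum_eq_single t, Finset.sum_eq_single (k t),
      F.evenCoord_even t t _ _ le_rfl le_rfl rfl rfl, mul_one]
    · rw [show ε t (i + k t) = _ from dif_pos ⟨by omega, by omega⟩]
      congr 2
      exact Fin.ext (by simp)
    · intro l hl hne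
      have := Finset.mem_range.1 hl
      rw [F.evenCoord_even_ne t t _ _ le_rfl (by omega) (Or.inr hne.symm), mul_zero]
    · intro h
      simp at h
    · intro s _ hst
      refine Finset.sum_eq_zero fun l hl => ?_
      have := Finset.mem_range.1 hl
      rw [F.evenCoord_even_ne t s _ _ le_rfl (by omega) (Or.inl hst.symm), mul_zero]
    · simp

theorem finrank_kernelSeq [FiniteDimensional ℂ W] (hF : F.IsMaximal)
    (h₁ : ∀ x y, B₁ x y = - B₁ y x) (h₂ : ∀ x y, B₂ x y = - B₂ y x) (d : ℕ) :
    Module.finrank ℂ (kernelSeq B₁ B₂ d) = ∑ t, (d - k t) := by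
  rw [(LinearEquiv.ofBijective (F.kernelSeqCoord d) ⟨F.kernelSeqCoord_injective hF h₁ h₂ d,
    F.kernelSeqCoord_surjective d⟩).finrank_eq]
  simp

end KroneckerFrame

end KernelSequences

/-! ### Recovering block sizes from truncated sums -/

theorem card_fiber_zero {R : Type*} [Fintype R] (κ : R → ℕ) :
    Fintype.card {r // κ r = 0} = ∑ r, (1 - κ r) := by
  rw [Fintype.card_subtype, Finset.card_filter]
  refine Finset.sum_congr rfl fun r _ => ?_
  split_ifs <;> omega

/-- The second difference of `d ↦ (d - κ)⁺` is the indicator of one value of `κ`; the identity is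
stated without subtraction of sums. -/
theorem card_fiber_succ {R : Type*} [Fintype R] (κ : R → ℕ) (d : ℕ) :
    Fintype.card {r // κ r = d + 1} + 2 * ∑ r, (d + 1 - κ r) =
      ∑ r, (d + 2 - κ r) + ∑ r, (d - κ r) := by
  rw [Fintype.card_subtype, Finset.card_filter, Finset.mul_sum, ← Finset.sum_add_distrib,
    ← Finset.sum_add_distrib]
  refine Finset.sum_congr rfl fun r _ => ?_
  split_ifs <;> omega

/-- Families of natural numbers with the same truncated sums agree up to a permutation. -/
theorem exists_equiv_of_sum_tsub_eq {S T : Type*} [Fintype S] [Fintype T] {k : S → ℕ} {k' : T → ℕ}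
    {m : ℕ} (hk : ∀ s, k s ≤ m) (hk' : ∀ t, k' t ≤ m)
    (h : ∀ d ≤ m + 1, ∑ s, (d - k s) = ∑ t, (d - k' t)) : ∃ σ : S ≃ T, k' ∘ σ = k := by
  classical
  have hcard : ∀ d, Fintype.card {s // k s = d} = Fintype.card {t // k' t = d} := by
    intro d
    rcases le_or_gt d m with hd | hd
    · cases d with
      | zero => rw [card_fiber_zero, card_fiber_zero, h 1 (by omega)]
      | succ d =>
        have e1 := card_fiber_succ k d
        have e2 := card_fiber_succ k' d
        rw [h _ (by omega), h _ (by omega), h _ (by omega)] at e1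
        omega
    · rw [Fintype.card_eq_zero_iff.2 ⟨fun s => by have := hk s.1; have := s.2; omega⟩,
        Fintype.card_eq_zero_iff.2 ⟨fun t => by have := hk' t.1; have := t.2; omega⟩]
  let e : ∀ d, {s // k s = d} ≃ {t // k' t = d} := fun d => Fintype.equivOfCardEq (hcard d)
  refine ⟨((Equiv.sigmaFiberEquiv k).symm.trans (Equiv.sigmaCongrRight e)).trans
    (Equiv.sigmaFiberEquiv k'), ?_⟩
  funext s
  exact (e (k s) ⟨s, rfl⟩).2

/-! ### Semicontinuity of kernel dimensions -/

section Semicontinuity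

/-- The dimension of the kernel is upper semicontinuous. -/
theorem eventually_finrank_ker_le {X Y Z : Type*} [TopologicalSpace X] [NormedAddCommGroup Y]
    [NormedSpace ℂ Y] [FiniteDimensional ℂ Y] [NormedAddCommGroup Z] [NormedSpace ℂ Z]
    [FiniteDimensional ℂ Z] {Φ : X → Y →ₗ[ℂ] Z} {x : X}
    (hΦ : ∀ y, ContinuousAt (fun x => Φ x y) x) :
    ∀ᶠ x' in 𝓝 x, Module.finrank ℂ (LinearMap.ker (Φ x')) ≤
      Module.finrank ℂ (LinearMap.ker (Φ x)) := by
  let Ψ : X → Y →L[ℂ] Z := fun x => LinearMap.toContinuousLinearMap (Φ x)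
  have hΨ : ContinuousAt Ψ x := by
    rw [← continuousWithinAt_univ, continuousWithinAt_clm_apply]
    intro y
    rw [continuousWithinAt_univ]
    exact hΦ y
  have hopen := isOpen_setOfPred_nat_le_rank (𝕜 := ℂ) (E := Y) (F := Z)
    (Module.finrank ℂ (LinearMap.range (Φ x)))
  have hrank : ∀ (f : Y →ₗ[ℂ] Z), f.rank = (Module.finrank ℂ (LinearMap.range f) : Cardinal) :=
    fun f => (Module.finrank_eq_rank ℂ _).symm
  have hmem : Ψ x ∈ {f : Y →L[ℂ] Z | (Module.finrank ℂ (LinearMap.range (Φ x)) : Cardinal) ≤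
      (f : Y →ₗ[ℂ] Z).rank} := (hrank (Φ x)).ge
  filter_upwards [hΨ.eventually (hopen.mem_nhds hmem)] with x' hx'
  have h1 : Module.finrank ℂ (LinearMap.range (Φ x)) ≤
      Module.finrank ℂ (LinearMap.range (Φ x')) := by
    have h2 : (Module.finrank ℂ (LinearMap.range (Φ x)) : Cardinal) ≤ (Φ x').rank := hx'
    rw [hrank] at h2
    exact_mod_cast h2
  have := (Φ x).finrank_range_add_finrank_ker
  have := (Φ x').finrank_range_add_finrank_ker
  omega

/-- The coefficients of `(B₁ + λ B₂) z(λ)` for polynomials `z` of degree less than `d` and pairings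
given by matrices. -/
def pencilMap {n : ℕ} (A₁ A₂ : Matrix (Fin n) (Fin n) ℂ) (d : ℕ) :
    (Fin d → Fin n → ℂ) →ₗ[ℂ] (Fin (d + 1) → Fin n → ℂ) where
  toFun z i j := (if h : (i : ℕ) < d then ∑ p, z ⟨i, h⟩ p * A₁ p j else 0) +
    (if h : 0 < (i : ℕ) then ∑ p, z ⟨i - 1, by omega⟩ p * A₂ p j else 0)
  map_add' y z := by
    ext i j
    simp only [Pi.add_apply, add_mul, Finset.sum_add_distrib]
    split_ifs <;> ring
  map_smul' c z := by
    ext i j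
    simp only [Pi.smul_apply, smul_eq_mul, mul_assoc, ← Finset.mul_sum, RingHom.id_apply]
    split_ifs <;> ring

theorem pencilMap_apply {n : ℕ} (A₁ A₂ : Matrix (Fin n) (Fin n) ℂ) (d : ℕ)
    (z : Fin d → Fin n → ℂ) (i : Fin (d + 1)) (j : Fin n) : pencilMap A₁ A₂ d z i j =
      (if h : (i : ℕ) < d then ∑ p, z ⟨i, h⟩ p * A₁ p j else 0) +
      (if h : 0 < (i : ℕ) then ∑ p, z ⟨i - 1, by omega⟩ p * A₂ p j else 0) := rfl

/-- This replaces kernel sequences in a space varying with the point by the kernel of a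
matrix-dependent map between fixed spaces, to which semicontinuity applies. -/
theorem finrank_kernelSeq_eq {W : Type*} [AddCommGroup W] [Module ℂ W]
    {B₁ B₂ : LinearMap.BilinForm ℂ W} {n : ℕ} (e : Module.Basis (Fin n) ℂ W)
    {A₁ A₂ : Matrix (Fin n) (Fin n) ℂ} (h₁ : ∀ i j, B₁ (e i) (e j) = A₁ i j)
    (h₂ : ∀ i j, B₂ (e i) (e j) = A₂ i j) (d : ℕ) :
    Module.finrank ℂ (kernelSeq B₁ B₂ d) =
      Module.finrank ℂ (LinearMap.ker (pencilMap A₁ A₂ d)) := by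
  have hexp : ∀ (B : LinearMap.BilinForm ℂ W) (A : Matrix (Fin n) (Fin n) ℂ),
      (∀ i j, B (e i) (e j) = A i j) → ∀ (c : Fin n → ℂ) j,
      B (∑ p, c p • e p) (e j) = ∑ p, c p * A p j := by
    intro B A hA c j
    simp [map_sum, LinearMap.sum_apply, hA]
  let R : kernelSeq B₁ B₂ d →ₗ[ℂ] (Fin d → Fin n → ℂ) :=
    LinearMap.pi fun i => e.equivFun.toLinearMap.comp
      ((LinearMap.proj (i : ℕ)).comp (kernelSeq B₁ B₂ d).subtype)
  have hR : ∀ z i, R z i = e.equivFun (z.1 i) := fun z i => rfl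
  have hinj : Function.Injective R := by
    rw [← LinearMap.ker_eq_bot, LinearMap.ker_eq_bot']
    intro z hz
    refine Subtype.ext (funext fun i => ?_)
    rcases lt_or_ge i d with hi | hi
    · have := congrFun hz ⟨i, hi⟩
      rw [hR] at this
      exact (LinearEquiv.map_eq_zero_iff _).1 this
    · exact z.2.1 i hi
  rw [← LinearMap.finrank_range_of_inj hinj]
  suffices LinearMap.range R = LinearMap.ker (pencilMap A₁ A₂ d) by rw [this]
  ext y
  rw [LinearMap.mem_ker]
  constructor
  · rintro ⟨⟨z, hd, h0, hs⟩, rfl⟩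
    ext i j
    have hsum : ∀ (B : LinearMap.BilinForm ℂ W) (A : Matrix (Fin n) (Fin n) ℂ),
        (∀ i j, B (e i) (e j) = A i j) → ∀ i, ∑ p, e.equivFun (z i) p * A p j = B (z i) (e j) := by
      intro B A hA i
      rw [← hexp B A hA, e.sum_equivFun]
    have key : ∀ i : ℕ, (if i < d then B₁ (z i) (e j) else 0) +
        (if 0 < i then B₂ (z (i - 1)) (e j) else 0) = 0 := by
      intro i
      have hif : (if i < d then B₁ (z i) (e j) else 0) = B₁ (z i) (e j) := by
        split_ifs with h
        · rfl
        · rw [hd i (by omega), map_zero, LinearMap.zero_apply]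
      rw [hif]
      cases i with
      | zero => simp [h0]
      | succ i => simp [hs]
    rw [pencilMap_apply]
    simp only [hR, hsum B₁ A₁ h₁, hsum B₂ A₂ h₂, dite_eq_ite]
    exact key i
  · intro hy
    let z : ℕ → W := fun i => if h : i < d then ∑ p, y ⟨i, h⟩ p • e p else 0
    have key : ∀ (i : ℕ) (hi : i < d + 1) j, B₁ (z i) (e j) +
        (if 0 < i then B₂ (z (i - 1)) (e j) else 0) = 0 := by
      intro i hi j
      have := congrFun (congrFun hy ⟨i, hi⟩) j
      rw [pencilMap_apply] at this
      simp only [Pi.zero_apply] at this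
      refine Eq.trans (congrArg₂ (· + ·) ?_ ?_) this
      · simp only [z]
        split_ifs
        · exact hexp B₁ A₁ h₁ _ j
        · simp
      · by_cases h : 0 < i
        · rw [if_pos h, dif_pos h]
          simp only [z]
          rw [dif_pos (by omega)]
          exact hexp B₂ A₂ h₂ _ j
        · rw [if_neg h, dif_neg h]
    have hz : z ∈ kernelSeq B₁ B₂ d := by
      refine ⟨fun i hi => dif_neg (by omega), e.ext fun j => ?_, fun i => e.ext fun j => ?_⟩
      · simpa using key 0 (by omega) j
      · rcases lt_or_ge i d with hi | hi
        · have := key (i + 1) (by omega) j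
          simp only [Nat.add_sub_cancel, Nat.succ_pos, if_true] at this
          rw [LinearMap.neg_apply]
          linear_combination this
        · simp only [z]
          rw [dif_neg (by omega), dif_neg (by omega)]
          simp
    refine ⟨⟨z, hz⟩, ?_⟩
    ext i p
    rw [hR]
    have : z i = e.equivFun.symm (y i) := by
      simp only [z]
      rw [dif_pos i.2, e.equivFun_symm_apply]
    simp only [this, LinearEquiv.apply_symm_apply]

theorem continuousAt_pencilMap {X : Type*} [TopologicalSpace X] {n : ℕ}
    {A₁ A₂ : X → Matrix (Fin n) (Fin n) ℂ} {x : X} (h₁ : ∀ i j, ContinuousAt (fun x => A₁ x i j) x)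
    (h₂ : ∀ i j, ContinuousAt (fun x => A₂ x i j) x) (d : ℕ) (z : Fin d → Fin n → ℂ) :
    ContinuousAt (fun x => pencilMap (A₁ x) (A₂ x) d z) x := by
  refine continuousAt_pi.2 fun i => continuousAt_pi.2 fun j => ?_
  simp only [pencilMap_apply]
  refine ContinuousAt.add ?_ ?_
  · split_ifs
    · exact tendsto_finsetSum _ fun p _ => tendsto_const_nhds.mul (h₁ p j)
    · exact continuousAt_const
  · split_ifs
    · exact tendsto_finsetSum _ fun p _ => tendsto_const_nhds.mul (h₂ p j)
    · exact continuousAt_const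

end Semicontinuity

/-! ### Continuous families of pairs: generic constancy of the type -/

section Families

variable {X : Type*} [TopologicalSpace X] {V : X → Type*} [∀ x, AddCommGroup (V x)]
  [∀ x, Module ℂ (V x)] {B₁ B₂ : (x : X) → LinearMap.BilinForm ℂ (V x)}

/-- The pairings depend continuously on the point near `x₀`, with respect to suitable bases. -/
def IsContinuousFamilyAt (B₁ B₂ : (x : X) → LinearMap.BilinForm ℂ (V x)) (n : ℕ) (x₀ : X) : Prop :=
  ∃ A₁ A₂ : X → Matrix (Fin n) (Fin n) ℂ,
    (∀ i j, ContinuousAt (fun x => A₁ x i j) x₀) ∧ (∀ i j, ContinuousAt (fun x => A₂ x i j) x₀) ∧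
    ∀ᶠ x in 𝓝 x₀, ∃ e : Module.Basis (Fin n) ℂ (V x), ∀ i j,
      B₁ x (e i) (e j) = A₁ x i j ∧ B₂ x (e i) (e j) = A₂ x i j

theorem IsContinuousFamilyAt.eventually_finrank_kernelSeq_le {n : ℕ} {x₀ : X}
    (h : IsContinuousFamilyAt B₁ B₂ n x₀) (d : ℕ) :
    ∀ᶠ x in 𝓝 x₀, Module.finrank ℂ (kernelSeq (B₁ x) (B₂ x) d) ≤
      Module.finrank ℂ (kernelSeq (B₁ x₀) (B₂ x₀) d) := by
  obtain ⟨A₁, A₂, h₁, h₂, he⟩ := h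
  obtain ⟨e₀, he₀⟩ := he.self_of_nhds
  filter_upwards [he, eventually_finrank_ker_le (continuousAt_pencilMap h₁ h₂ d)] with x hx hx'
  obtain ⟨e, he⟩ := hx
  rw [finrank_kernelSeq_eq e (fun i j => (he i j).1) (fun i j => (he i j).2),
    finrank_kernelSeq_eq e₀ (fun i j => (he₀ i j).1) (fun i j => (he₀ i j).2)]
  exact hx'

theorem IsContinuousFamilyAt.eventually_finrank {n : ℕ} {x₀ : X}
    (h : IsContinuousFamilyAt B₁ B₂ n x₀) :
    ∀ᶠ x in 𝓝 x₀, FiniteDimensional ℂ (V x) ∧ Module.finrank ℂ (V x) = n := by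
  obtain ⟨A₁, A₂, h₁, h₂, he⟩ := h
  filter_upwards [he] with x ⟨e, _⟩
  exact ⟨.of_basis e, by simpa using Module.finrank_eq_card_basis e⟩

/-- The number of Kronecker blocks is upper semicontinuous. -/
theorem IsContinuousFamilyAt.eventually_numKroneckerBlocks_le {n : ℕ} {x₀ : X}
    (h : IsContinuousFamilyAt B₁ B₂ n x₀) (h₁ : ∀ x y z, B₁ x y z = - B₁ x z y)
    (h₂ : ∀ x y z, B₂ x y z = - B₂ x z y) :
    ∀ᶠ x in 𝓝 x₀, numKroneckerBlocks (B₁ x) (B₂ x) ≤ numKroneckerBlocks (B₁ x₀) (B₂ x₀) := by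
  have hdim := h.eventually_finrank
  -- For `d = n + 1` the dimension `∑ (d - k t)` differs from `ρ d` by `∑ k t ≤ n < d`, so one extra
  -- block could not be compensated.
  filter_upwards [hdim, h.eventually_finrank_kernelSeq_le (n + 1)] with x ⟨_, hn⟩ hle
  obtain ⟨_, hn₀⟩ := hdim.self_of_nhds
  obtain ⟨k, F, hF⟩ := exists_maximal_frame (h₁ x) (h₂ x)
  obtain ⟨k₀, F₀, hF₀⟩ := exists_maximal_frame (h₁ x₀) (h₂ x₀)
  rw [F.finrank_kernelSeq hF (h₁ x) (h₂ x), F₀.finrank_kernelSeq hF₀ (h₁ x₀) (h₂ x₀)] at hle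
  have h3 : ∑ t, (n + 1 - k₀ t) ≤ numKroneckerBlocks (B₁ x₀) (B₂ x₀) * (n + 1) := by
    refine (Finset.sum_le_card_nsmul _ _ (n + 1) fun t _ => Nat.sub_le _ _).trans ?_
    simp
  have h4 : numKroneckerBlocks (B₁ x) (B₂ x) * (n + 1) ≤ ∑ t, (n + 1 - k t) + ∑ t, k t := by
    rw [← Finset.sum_add_distrib]
    have := Finset.card_nsmul_le_sum Finset.univ (fun t => n + 1 - k t + k t) (n + 1)
      fun t _ => by omega
    simpa using this
  have h5 : ∑ t, k t ≤ ∑ t, (2 * k t + 1) := Finset.sum_le_sum fun t _ => by omega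
  have h6 := F.finrank_eq
  by_contra! hlt
  have h7 : (numKroneckerBlocks (B₁ x₀) (B₂ x₀) + 1) * (n + 1) ≤
      numKroneckerBlocks (B₁ x) (B₂ x) * (n + 1) := Nat.mul_le_mul_right _ hlt
  rw [add_mul, one_mul] at h7
  omega

theorem KroneckerFrame.le_finrank {W : Type*} [AddCommGroup W] [Module ℂ W]
    [FiniteDimensional ℂ W] {b₁ b₂ : LinearMap.BilinForm ℂ W} {T : Type*} [Fintype T] {k : T → ℕ}
    (F : KroneckerFrame b₁ b₂ T k) (t : T) : k t ≤ Module.finrank ℂ W := by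
  have h : 2 * k t + 1 ≤ ∑ t, (2 * k t + 1) :=
    Finset.single_le_sum (f := fun t => 2 * k t + 1) (fun _ _ => Nat.zero_le _) (Finset.mem_univ t)
  have := F.finrank_eq
  omega

theorem KroneckerFrame.isMaximal_of_compl_eq_bot {W : Type*} [AddCommGroup W] [Module ℂ W]
    {b₁ b₂ : LinearMap.BilinForm ℂ W} {T : Type*} {k : T → ℕ}
    (F : KroneckerFrame b₁ b₂ T k) (hF : F.compl = ⊥) : F.IsMaximal :=
  ⟨0, fun x _ => Subtype.ext ((Submodule.mem_bot ℂ).1 (hF ▸ x.2))⟩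

/-- A continuous family of sums of Kronecker blocks has locally constant type somewhere. -/
theorem exists_isOpen_isKroneckerSum_const {n : ℕ} {O : Set X} (hO : IsOpen O) (hne : O.Nonempty)
    (hcont : ∀ x ∈ O, IsContinuousFamilyAt B₁ B₂ n x) (h₁ : ∀ x y z, B₁ x y z = - B₁ x z y)
    (h₂ : ∀ x y z, B₂ x y z = - B₂ x z y)
    (hK : ∀ x ∈ O, ∃ (l : ℕ) (k : Fin l → ℕ) (F : KroneckerFrame (B₁ x) (B₂ x) (Fin l) k),
      F.compl = ⊥) :
    ∃ O' ⊆ O, IsOpen O' ∧ O'.Nonempty ∧ ∃ (l : Fin (n + 1)) (k : Fin l → Fin (n + 1)),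
      ∀ x ∈ O', IsKroneckerSum (B₁ x) (B₂ x) fun t => (k t : ℕ) := by
  -- Each summand can only drop near a point, so near a minimum of the sum all summands are
  -- constant. The degrees `d ≤ n + 1` suffice because block parameters are at most `n`.
  let f : X → ℕ := fun x => ∑ d ∈ Finset.range (n + 2),
    Module.finrank ℂ (kernelSeq (B₁ x) (B₂ x) d)
  let x₀ := Function.argminOn f O hne
  have hx₀ : x₀ ∈ O := Function.argminOn_mem f O hne
  have hmin : ∀ x ∈ O, f x₀ ≤ f x := fun x hx => Function.argminOn_le f O hx
  obtain ⟨l, k, F, hF⟩ := hK x₀ hx₀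
  obtain ⟨_, hn₀⟩ := (hcont x₀ hx₀).eventually_finrank.self_of_nhds
  have hev : ∀ᶠ x in 𝓝 x₀, x ∈ O ∧ ∀ d ∈ Finset.range (n + 2),
      Module.finrank ℂ (kernelSeq (B₁ x) (B₂ x) d) ≤
        Module.finrank ℂ (kernelSeq (B₁ x₀) (B₂ x₀) d) :=
    Filter.Eventually.and (hO.mem_nhds hx₀) ((Filter.eventually_all_finset _).2 fun d _ =>
      (hcont x₀ hx₀).eventually_finrank_kernelSeq_le d)
  obtain ⟨O', hO'sub, hO', hx₀'⟩ := eventually_nhds_iff.1 hev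
  have hl : l ≤ n := hn₀ ▸ F.splitsKroneckerBlocks.le_finrank
  have hk : ∀ t, k t ≤ n := fun t => hn₀ ▸ F.le_finrank t
  refine ⟨O', fun x hx => (hO'sub x hx).1, hO', ⟨x₀, hx₀'⟩, ⟨l, by omega⟩,
    fun t => ⟨k t, by have := hk t; omega⟩, fun x hx => ?_⟩
  obtain ⟨hxO, hxle⟩ := hO'sub x hx
  obtain ⟨_, hn⟩ := (hcont x hxO).eventually_finrank.self_of_nhds
  obtain ⟨l', k', F', hF'⟩ := hK x hxO
  have heq := (Finset.sum_eq_sum_iff_of_le hxle).1 ((Finset.sum_le_sum hxle).antisymm (hmin x hxO))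
  obtain ⟨σ, hσ⟩ := exists_equiv_of_sum_tsub_eq (k := k) (k' := k') (m := n) hk
    (fun t => hn ▸ F'.le_finrank t) fun d hd => by
      have := heq d (Finset.mem_range.2 (by omega))
      rw [F.finrank_kernelSeq (F.isMaximal_of_compl_eq_bot hF) (h₁ x₀) (h₂ x₀),
        F'.finrank_kernelSeq (F'.isMaximal_of_compl_eq_bot hF') (h₁ x) (h₂ x)] at this
      exact this.symm
  subst hσ
  refine (F'.reindex σ).isKroneckerSum ?_
  refine eq_bot_iff.2 fun y hy => ?_
  rw [← hF']
  rw [KroneckerFrame.mem_compl'] at hy ⊢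
  refine ⟨fun t m hm => ?_, fun t m hm => ?_⟩
  · obtain ⟨s, rfl⟩ := σ.surjective t
    exact hy.1 s m hm
  · obtain ⟨s, rfl⟩ := σ.surjective t
    exact hy.2 s m hm

/-- If a continuous family of pairs has arbitrarily close to `x₀` at most `ρ` Kronecker blocks, and
those members of the family are generically sums of Kronecker blocks, then they are so with a
constant type on an open set whose closure contains `x₀`. -/
theorem exists_isOpen_isKroneckerSum {n ρ : ℕ} {x₀ : X} {N G : Set X} (hN : IsOpen N)
    (hx₀ : x₀ ∈ N) (hG : IsOpen G) (hNG : N ⊆ closure G)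
    (hcont : ∀ x ∈ N, IsContinuousFamilyAt B₁ B₂ n x) (h₁ : ∀ x y z, B₁ x y z = - B₁ x z y)
    (h₂ : ∀ x y z, B₂ x y z = - B₂ x z y)
    (hfreq : ∃ᶠ x in 𝓝 x₀, numKroneckerBlocks (B₁ x) (B₂ x) ≤ ρ)
    (hK : ∀ x ∈ N ∩ G, numKroneckerBlocks (B₁ x) (B₂ x) ≤ ρ →
      ∃ (l : ℕ) (k : Fin l → ℕ) (F : KroneckerFrame (B₁ x) (B₂ x) (Fin l) k), F.compl = ⊥) :
    ∃ U : Set X, IsOpen U ∧ x₀ ∈ closure U ∧ ∃ (l : ℕ) (k : Fin l → ℕ),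
      ∀ x ∈ U, IsKroneckerSum (B₁ x) (B₂ x) k := by
  let τ := Σ l : Fin (n + 1), (Fin l → Fin (n + 1))
  let C : τ → Set X := fun κ =>
    interior {x | IsKroneckerSum (B₁ x) (B₂ x) fun t => (κ.2 t : ℕ)}
  -- There are finitely many types `κ`, so a point in the closure of the union lies in the closure
  -- of one `C κ`.
  suffices hcl : x₀ ∈ closure (⋃ κ, C κ) by
    rw [closure_iUnion_of_finite] at hcl
    obtain ⟨κ, hκ⟩ := Set.mem_iUnion.1 hcl
    exact ⟨C κ, isOpen_interior, hκ, κ.1, fun t => κ.2 t, fun x hx =>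
      interior_subset (s := {x | IsKroneckerSum (B₁ x) (B₂ x) fun t => (κ.2 t : ℕ)}) hx⟩
  rw [mem_closure_iff]
  intro O hO hxO
  obtain ⟨x, hxρ, hxO', hxN⟩ := (hfreq.and_eventually
    (Filter.Eventually.and (hO.mem_nhds hxO) (hN.mem_nhds hx₀))).exists
  -- The point `x` itself need not lie in `G`; the bound `ρ` spreads to a neighbourhood of it, and
  -- that meets `G`.
  obtain ⟨O₁, hO₁, hO₁open, hxO₁⟩ := eventually_nhds_iff.1
    ((hcont x hxN).eventually_numKroneckerBlocks_le h₁ h₂)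
  have hopen : IsOpen (O ∩ N ∩ O₁) := (hO.inter hN).inter hO₁open
  obtain ⟨y, hy, hyG⟩ := mem_closure_iff.1 (hNG hxN) _ hopen ⟨⟨hxO', hxN⟩, hxO₁⟩
  obtain ⟨O', hO', hO'open, ⟨w, hw⟩, l, k, hlk⟩ := exists_isOpen_isKroneckerSum_const
    (B₁ := B₁) (B₂ := B₂) (n := n)
    (hopen.inter hG) ⟨y, hy, hyG⟩ (fun x hx => hcont x hx.1.1.2) h₁ h₂
    fun x hx => hK x ⟨hx.1.1.2, hx.2⟩ ((hO₁ x hx.1.2).trans hxρ)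
  exact ⟨w, (hO' hw).1.1.1, Set.mem_iUnion.2 ⟨⟨l, k⟩, mem_interior.2 ⟨O', hlk, hO'open, hw⟩⟩⟩

end Families

/-! ### Linear dependence of differentials implies functional dependence -/

section FunctionalDependence

variable {𝕜 : Type*} [RCLike 𝕜] {E : Type*} [NormedAddCommGroup E] [NormedSpace 𝕜 E]

theorem range_pi_eq_top_of_linearIndependent {ι : Type*} [Finite ι] {f : ι → E →L[𝕜] 𝕜}
    (hf : LinearIndependent 𝕜 f) : (ContinuousLinearMap.pi f).range = ⊤ := by
  cases nonempty_fintype ι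
  by_contra hne
  obtain ⟨g, hg, hle⟩ := Submodule.exists_le_ker_of_lt_top _ (lt_top_iff_ne_top.2 hne)
  apply hg
  have hsum : ∑ i, g (Pi.basisFun 𝕜 ι i) • f i = 0 := by
    ext x
    have hx : g (ContinuousLinearMap.pi f x) = 0 := hle ⟨x, rfl⟩
    rw [← (Pi.basisFun 𝕜 ι).sum_repr (ContinuousLinearMap.pi f x), map_sum] at hx
    simpa [mul_comm] using hx
  exact (Pi.basisFun 𝕜 ι).ext fun i => by
    simpa using Fintype.linearIndependent_iff.1 hf _ hsum i

/-- Near a point at which the differentials of `G` are independent, and near which the differential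
of `f` depends on them, `f` is a smooth function of `G`. -/
theorem exists_factor_of_mem_span [FiniteDimensional 𝕜 E] {ι : Type*} [Fintype ι]
    {G : ι → E → 𝕜} {f : E → 𝕜} {O : Set E} (hO : IsOpen O) {x : E} (hx : x ∈ O)
    (hG : ∀ i, ContDiffOn 𝕜 ∞ (G i) O) (hf : ContDiffOn 𝕜 ∞ f O)
    (hind : LinearIndependent 𝕜 fun i => fderiv 𝕜 (G i) x)
    (hspan : ∀ y ∈ O, fderiv 𝕜 f y ∈ Submodule.span 𝕜 (Set.range fun i => fderiv 𝕜 (G i) y)) :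
    ∃ O' ⊆ O, IsOpen O' ∧ x ∈ O' ∧ ∃ (Ω : Set (ι → 𝕜)) (ψ : (ι → 𝕜) → 𝕜), IsOpen Ω ∧
      ContDiffOn 𝕜 ∞ ψ Ω ∧ ∀ y ∈ O', (fun i => G i y) ∈ Ω ∧ f y = ψ fun i => G i y := by
  have : CompleteSpace E := FiniteDimensional.complete 𝕜 E
  let D : E →L[𝕜] (ι → 𝕜) := ContinuousLinearMap.pi fun i => fderiv 𝕜 (G i) x
  have hD : D.range = ⊤ := range_pi_eq_top_of_linearIndependent hind
  obtain ⟨q, hq⟩ := Submodule.exists_isCompl D.ker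
  let π : E →L[𝕜] D.ker :=
    LinearMap.toContinuousLinearMap (Submodule.projectionOnto D.ker q hq)
  have hπ : π.range = ⊤ := Submodule.range_projectionOnto hq
  have hker : π.ker = q := Submodule.ker_projectionOnto hq
  let e : E ≃L[𝕜] (ι → 𝕜) × D.ker :=
    ContinuousLinearMap.equivProdOfSurjectiveOfIsCompl D π hD hπ (hker ▸ hq)
  -- The functions `G` are completed to local coordinates by a linear projection to the kernel of
  -- their differential at `x`.
  let Ψ : E → (ι → 𝕜) × D.ker := fun y => (fun i => G i y, π y)
  have hΨ : ContDiffOn 𝕜 ∞ Ψ O := (contDiffOn_pi.2 hG).prodMk π.contDiff.contDiffOn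
  have hΨx : ContDiffAt 𝕜 ∞ Ψ x := hΨ.contDiffAt (hO.mem_nhds hx)
  have hderiv : HasFDerivAt Ψ (e : E →L[𝕜] (ι → 𝕜) × D.ker) x := by
    have h1 : HasFDerivAt (fun y i => G i y) D x :=
      hasFDerivAt_pi.2 fun i => (((hG i).contDiffAt (hO.mem_nhds hx)).differentiableAt
        (by simp)).hasFDerivAt
    exact h1.prodMk π.hasFDerivAt
  have hn : (∞ : WithTop ℕ∞) ≠ 0 := by simp
  let Φ := hΨx.toOpenPartialHomeomorph Ψ hderiv hn
  have hΦ : ∀ y, Φ y = Ψ y := fun y => rfl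
  have hxΦ : x ∈ Φ.source := hΨx.mem_toOpenPartialHomeomorph_source hderiv hn
  -- Invertibility of the differential at nearby points makes the inverse smooth on a whole open
  -- set.
  have hinv : ∀ᶠ y in 𝓝 x, y ∈ O ∧ ∃ e' : E ≃L[𝕜] (ι → 𝕜) × D.ker, HasFDerivAt Ψ
      (e' : E →L[𝕜] (ι → 𝕜) × D.ker) y := by
    have hcont : ContinuousAt (fderiv 𝕜 Ψ) x :=
      (hΨ.continuousOn_fderiv_of_isOpen hO (by simp)).continuousAt (hO.mem_nhds hx)
    have hmem : fderiv 𝕜 Ψ x ∈ Set.range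
        ((↑) : (E ≃L[𝕜] (ι → 𝕜) × D.ker) → E →L[𝕜] (ι → 𝕜) × D.ker) := ⟨e, hderiv.fderiv.symm⟩
    filter_upwards [hO.mem_nhds hx,
      hcont.eventually (ContinuousLinearEquiv.isOpen.mem_nhds hmem)] with y hy ⟨e', he'⟩
    refine ⟨hy, e', ?_⟩
    rw [he']
    exact ((hΨ.contDiffAt (hO.mem_nhds hy)).differentiableAt (by simp)).hasFDerivAt
  obtain ⟨O₂, hO₂, hO₂open, hxO₂⟩ := eventually_nhds_iff.1 hinv
  let T := Φ.target ∩ Φ.symm ⁻¹' O₂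
  have hT : IsOpen T := Φ.symm.isOpen_inter_preimage hO₂open
  have hxT : Ψ x ∈ T := by
    refine ⟨Φ.map_source hxΦ, ?_⟩
    rw [Set.mem_preimage, ← hΦ, Φ.left_inv hxΦ]
    exact hxO₂
  have hsymm : ∀ p ∈ T, ContDiffAt 𝕜 ∞ Φ.symm p := by
    intro p hp
    obtain ⟨hy, e', he'⟩ := hO₂ _ hp.2
    exact Φ.contDiffAt_symm hp.1 he' (hΨ.contDiffAt (hO.mem_nhds hy))
  have hGsymm : ∀ p ∈ T, ∀ i, G i (Φ.symm p) = p.1 i := by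
    intro p hp i
    have : Ψ (Φ.symm p) = p := Φ.right_inv hp.1
    exact congrFun (congrArg Prod.fst this) i
  obtain ⟨ε, hε, hball⟩ := Metric.isOpen_iff.1 hT _ hxT
  have hbox : ∀ a ∈ Metric.ball (Ψ x).1 ε, ∀ b ∈ Metric.ball (Ψ x).2 ε, (a, b) ∈ T := by
    intro a ha b hb
    apply hball
    rw [← ball_prod_same]
    exact ⟨ha, hb⟩
  have hcenter : (Ψ x).2 ∈ Metric.ball (Ψ x).2 ε := Metric.mem_ball_self hε
  -- On a slice where `G = a` is fixed the differentials of all `G i` vanish, hence so does that of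
  -- `f`, and the slice is connected.
  have hconst : ∀ a ∈ Metric.ball (Ψ x).1 ε, ∀ b ∈ Metric.ball (Ψ x).2 ε,
      f (Φ.symm (a, b)) = f (Φ.symm (a, (Ψ x).2)) := by
    intro a ha b hb
    let γ : D.ker → E := fun b => Φ.symm (a, b)
    have hγ : ∀ b ∈ Metric.ball (Ψ x).2 ε, HasFDerivAt γ (fderiv 𝕜 γ b) b := by
      intro b hb
      have h1 : DifferentiableAt 𝕜 Φ.symm (a, b) :=
        (hsymm _ (hbox a ha b hb)).differentiableAt (by simp)
      have h2 : DifferentiableAt 𝕜 (fun b : D.ker => (a, b)) b := by fun_prop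
      exact (DifferentiableAt.comp (g := Φ.symm) b h1 h2).hasFDerivAt
    have hγO : ∀ b ∈ Metric.ball (Ψ x).2 ε, γ b ∈ O := fun b hb =>
      (hO₂ _ (hbox a ha b hb).2).1
    have hkill : ∀ b ∈ Metric.ball (Ψ x).2 ε, (fderiv 𝕜 f (γ b)).comp (fderiv 𝕜 γ b) = 0 := by
      intro b hb
      refine Submodule.span_induction (p := fun ℓ _ => ℓ.comp (fderiv 𝕜 γ b) = 0)
        ?_ ?_ ?_ ?_ (hspan _ (hγO b hb))
      · rintro _ ⟨i, rfl⟩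
        have h1 : HasFDerivAt (fun b => G i (γ b)) ((fderiv 𝕜 (G i) (γ b)).comp (fderiv 𝕜 γ b)) b :=
          HasFDerivAt.comp b (((hG i).contDiffAt (hO.mem_nhds (hγO b hb))).differentiableAt
            (by simp)).hasFDerivAt (hγ b hb)
        have h2 : HasFDerivAt (fun b => G i (γ b)) (0 : D.ker →L[𝕜] 𝕜) b := by
          refine (hasFDerivAt_const (a i) b).congr_of_eventuallyEq ?_
          filter_upwards [Metric.isOpen_ball.mem_nhds hb] with b' hb'
          exact hGsymm _ (hbox a ha b' hb') i
        exact h1.unique h2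
      · exact ContinuousLinearMap.zero_comp _
      · intro ℓ ℓ' _ _ h h'
        rw [ContinuousLinearMap.add_comp, h, h', add_zero]
      · intro c ℓ _ h
        ext v
        have hv : ℓ (fderiv 𝕜 γ b v) = 0 := DFunLike.congr_fun h v
        simp [hv]
    have hfγ : ∀ b ∈ Metric.ball (Ψ x).2 ε, HasFDerivAt (fun b => f (γ b))
        ((fderiv 𝕜 f (γ b)).comp (fderiv 𝕜 γ b)) b := fun b hb =>
      HasFDerivAt.comp b ((hf.contDiffAt (hO.mem_nhds (hγO b hb))).differentiableAt
        (by simp)).hasFDerivAt (hγ b hb)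
    let _ : NormedSpace ℝ D.ker := NormedSpace.restrictScalars ℝ 𝕜 D.ker
    exact Metric.isOpen_ball.is_const_of_fderiv_eq_zero (𝕜 := 𝕜)
      (convex_ball (Ψ x).2 ε).isPreconnected
      (fun b hb => (hfγ b hb).differentiableAt.differentiableWithinAt)
      (fun b hb => ((hfγ b hb).fderiv.trans (hkill b hb))) hb hcenter
  refine ⟨Φ.source ∩ Φ ⁻¹' (Metric.ball (Ψ x) ε), ?_, Φ.isOpen_inter_preimage Metric.isOpen_ball,
    ⟨hxΦ, Metric.mem_ball_self hε⟩, Metric.ball (Ψ x).1 ε,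
    fun a => f (Φ.symm (a, (Ψ x).2)), Metric.isOpen_ball, ?_, ?_⟩
  · rintro y ⟨hy, hy'⟩
    have := (hO₂ _ (hball hy').2).1
    rwa [Φ.left_inv hy] at this
  · intro a ha
    have hT' := hbox a ha _ hcenter
    have h1 : ContDiffAt 𝕜 ∞ (fun a : ι → 𝕜 => (a, (Ψ x).2)) a := by fun_prop
    have h2 : ContDiffAt 𝕜 ∞ f (Φ.symm (a, (Ψ x).2)) :=
      hf.contDiffAt (hO.mem_nhds (hO₂ _ hT'.2).1)
    exact (ContDiffAt.comp a h2 (ContDiffAt.comp a (hsymm _ hT') h1)).contDiffWithinAt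
  · rintro y ⟨hy, hy'⟩
    have hy'' : Ψ y ∈ Metric.ball (Ψ x).1 ε ×ˢ Metric.ball (Ψ x).2 ε := by
      rw [ball_prod_same]
      exact hy'
    refine ⟨hy''.1, ?_⟩
    have := hconst _ hy''.1 _ hy''.2
    rw [show ((Ψ y).1, (Ψ y).2) = Φ y from rfl, Φ.left_inv hy] at this
    exact this

/-- Functions whose differentials are linearly dependent everywhere are functionally dependent
somewhere. -/
theorem exists_dependence [FiniteDimensional 𝕜 E] {ι : Type*} [Fintype ι] {F : ι → E → 𝕜}
    {O : Set E} (hO : IsOpen O) (hne : O.Nonempty) (hF : ∀ i, ContDiffOn 𝕜 ∞ (F i) O)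
    (hdep : ∀ x ∈ O, ¬ LinearIndependent 𝕜 fun i => fderiv 𝕜 (F i) x) :
    ∃ O' ⊆ O, IsOpen O' ∧ O'.Nonempty ∧ ∃ (Ω : Set (ι → 𝕜)) (φ : (ι → 𝕜) → 𝕜), IsOpen Ω ∧
      ContDiffOn 𝕜 ∞ φ Ω ∧ (∀ Ω' ⊆ Ω, IsOpen Ω' → Ω'.Nonempty → ∃ y ∈ Ω', φ y ≠ 0) ∧
      ∀ x ∈ O', (fun i => F i x) ∈ Ω ∧ φ (fun i => F i x) = 0 := by
  classical
  -- The maximal rank on `O` is attained at some `x` by a subset `s`. It is kept near `x`, so there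
  -- any further differential lies in the span of those in `s`.
  let p : ℕ → Prop := fun c => ∃ s : Finset ι, s.card = c ∧ ∃ x ∈ O,
    LinearIndepOn 𝕜 (fun i => fderiv 𝕜 (F i) x) (s : Set ι)
  have hp0 : p 0 := by
    obtain ⟨x, hx⟩ := hne
    exact ⟨∅, rfl, x, hx, by simp⟩
  obtain ⟨s, hs, x, hx, hind⟩ : p (Nat.findGreatest p (Fintype.card ι)) :=
    Nat.findGreatest_spec (Nat.zero_le _) hp0
  have hmax : ∀ s' : Finset ι, ∀ y ∈ O,
      LinearIndepOn 𝕜 (fun i => fderiv 𝕜 (F i) y) (s' : Set ι) → s'.card ≤ s.card := by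
    intro s' y hy h
    rw [hs]
    exact Nat.le_findGreatest (Finset.card_le_univ s') ⟨s', rfl, y, hy, h⟩
  obtain ⟨j, hj⟩ : ∃ j, j ∉ s := by
    by_contra! hall
    apply hdep x hx
    rw [Finset.eq_univ_of_forall hall, Finset.coe_univ] at hind
    exact linearIndepOn_univ_iff.1 hind
  have hev : ∀ᶠ y in 𝓝 x, y ∈ O ∧
      LinearIndepOn 𝕜 (fun i => fderiv 𝕜 (F i) y) (s : Set ι) := by
    have hcont : ContinuousAt (fun y (i : (s : Set ι)) => fderiv 𝕜 (F i) y) x :=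
      continuousAt_pi.2 fun i => ((hF i).continuousOn_fderiv_of_isOpen hO (by simp)).continuousAt
        (hO.mem_nhds hx)
    exact Filter.Eventually.and (hO.mem_nhds hx)
      (hcont.eventually (isOpen_setOfPred_linearIndependent.mem_nhds hind))
  obtain ⟨O₁, hO₁, hO₁open, hxO₁⟩ := eventually_nhds_iff.1 hev
  have hspan : ∀ y ∈ O₁, fderiv 𝕜 (F j) y ∈
      Submodule.span 𝕜 (Set.range fun i : (s : Set ι) => fderiv 𝕜 (F i) y) := by
    intro y hy
    by_contra hnot
    have h1 : LinearIndepOn 𝕜 (fun i => fderiv 𝕜 (F i) y) (insert j s : Finset ι) := by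
      rw [Finset.coe_insert]
      refine (hO₁ y hy).2.insert ?_
      rwa [Set.image_eq_range]
    have := hmax _ y (hO₁ y hy).1 h1
    rw [Finset.card_insert_of_notMem hj] at this
    omega
  obtain ⟨O', hO'sub, hO', hxO', Ω, ψ, hΩ, hψ, hfac⟩ :=
    exists_factor_of_mem_span (G := fun (i : (s : Set ι)) => F i) (f := F j) hO₁open hxO₁
      (fun i => (hF i).mono fun y hy => (hO₁ y hy).1) ((hF j).mono fun y hy => (hO₁ y hy).1)
      hind hspan
  let r : (ι → 𝕜) → (↥(s : Set ι) → 𝕜) := fun v i => v i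
  have hr : ContDiff 𝕜 ∞ r := contDiff_pi.2 fun i => contDiff_apply 𝕜 𝕜 (i : ι)
  refine ⟨O', fun y hy => (hO₁ y (hO'sub hy)).1, hO', ⟨x, hxO'⟩, r ⁻¹' Ω,
    fun v => v j - ψ (r v), hΩ.preimage hr.continuous, ?_, ?_, ?_⟩
  · exact (contDiff_apply 𝕜 𝕜 j).contDiffOn.sub
      (hψ.comp hr.contDiffOn fun v hv => hv)
  -- The relation is `v j = ψ` of the coordinates in `s`. Varying the coordinate `j ∉ s` alone
  -- changes `φ`, so `φ` vanishes identically on no nonempty open set.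
  · rintro Ω' - hΩ' ⟨v, hv⟩
    by_contra! hzero
    have hcont : Continuous fun t : 𝕜 => Function.update v j (v j + t) :=
      continuous_const.update j (continuous_const.add continuous_id)
    have hmem : ∀ᶠ t in 𝓝 (0 : 𝕜), Function.update v j (v j + t) ∈ Ω' := by
      refine hcont.continuousAt.eventually (hΩ'.mem_nhds ?_)
      simpa using hv
    obtain ⟨t, ht, ht0⟩ := ((hmem.filter_mono nhdsWithin_le_nhds).and
      (self_mem_nhdsWithin : ({0}ᶜ : Set 𝕜) ∈ 𝓝[≠] (0 : 𝕜))).exists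
    have h1 := hzero _ ht
    have h2 := hzero _ hv
    have h3 : r (Function.update v j (v j + t)) = r v := by
      funext i
      have hij : (i : ι) ≠ j := fun h => hj (h ▸ Finset.mem_coe.1 i.2)
      exact Function.update_of_ne hij _ _
    rw [h3, Function.update_self] at h1
    exact ht0 (Set.mem_singleton_iff.2 (by linear_combination h1 - h2))
  · intro y hy
    obtain ⟨h1, h2⟩ := hfac y hy
    exact ⟨h1, sub_eq_zero.2 h2⟩

end FunctionalDependence

/-! ### Differentials in charts; generic linear independence -/

section Charts

variable {𝕜 : Type*} [RCLike 𝕜]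
  {E : Type*} [NormedAddCommGroup E] [NormedSpace 𝕜 E]
  {M : Type*} [TopologicalSpace M] [ChartedSpace E M]

/-- The differential of the chart at `x₀`. -/
def chartDifferential (𝕜 : Type*) [RCLike 𝕜] (E : Type*) [NormedAddCommGroup E]
    [NormedSpace 𝕜 E] {M : Type*} [TopologicalSpace M] [ChartedSpace E M] (x₀ m : M) :
    TangentSpace 𝓘(𝕜, E) m →L[𝕜] E :=
  mfderiv 𝓘(𝕜, E) 𝓘(𝕜, E) (extChartAt 𝓘(𝕜, E) x₀) m

theorem isOpen_chart_image {x₀ : M} {N : Set M} (hN : IsOpen N) :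
    IsOpen ((extChartAt 𝓘(𝕜, E) x₀).target ∩ (extChartAt 𝓘(𝕜, E) x₀).symm ⁻¹' N) :=
  (continuousOn_extChartAt_symm x₀).isOpen_inter_preimage (isOpen_extChartAt_target x₀) hN

theorem mem_chart_image {x₀ m : M} {N : Set M} (hm : m ∈ (extChartAt 𝓘(𝕜, E) x₀).source)
    (hmN : m ∈ N) : extChartAt 𝓘(𝕜, E) x₀ m ∈
      (extChartAt 𝓘(𝕜, E) x₀).target ∩ (extChartAt 𝓘(𝕜, E) x₀).symm ⁻¹' N := by
  refine ⟨(extChartAt 𝓘(𝕜, E) x₀).map_source hm, ?_⟩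
  rwa [Set.mem_preimage, (extChartAt 𝓘(𝕜, E) x₀).left_inv hm]

variable [IsManifold 𝓘(𝕜, E) ∞ M]

theorem smoothOn_comp_extChartAt (x₀ : M) {f : E → 𝕜} (hf : ContDiff 𝕜 ∞ f) :
    SmoothOn 𝕜 E (f ∘ extChartAt 𝓘(𝕜, E) x₀) (extChartAt 𝓘(𝕜, E) x₀).source := by
  have h1 : ContMDiffOn 𝓘(𝕜, E) 𝓘(𝕜, E) ∞ (extChartAt 𝓘(𝕜, E) x₀)
      (extChartAt 𝓘(𝕜, E) x₀).source := by
    rw [extChartAt_source]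
    exact contMDiffOn_extChartAt
  exact hf.contMDiff.comp_contMDiffOn h1

theorem differential_comp_extChartAt {x₀ m : M} (hm : m ∈ (extChartAt 𝓘(𝕜, E) x₀).source)
    {f : E → 𝕜} (hf : DifferentiableAt 𝕜 f (extChartAt 𝓘(𝕜, E) x₀ m)) :
    differential E (f ∘ extChartAt 𝓘(𝕜, E) x₀) m =
      (fderiv 𝕜 f (extChartAt 𝓘(𝕜, E) x₀ m)).comp (chartDifferential 𝕜 E x₀ m) := by
  have : IsManifold 𝓘(𝕜, E) 1 M := IsManifold.of_le (n := ∞) (by simp)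
  rw [extChartAt_source] at hm
  unfold differential chartDifferential
  rw [mfderiv_comp m hf.mdifferentiableAt (mdifferentiableAt_extChartAt hm), mfderiv_eq_fderiv]
  rfl

theorem isInvertible_chartDifferential {x₀ m : M} (hm : m ∈ (extChartAt 𝓘(𝕜, E) x₀).source) :
    (chartDifferential 𝕜 E x₀ m).IsInvertible := by
  have : IsManifold 𝓘(𝕜, E) 1 M := IsManifold.of_le (n := ∞) (by simp)
  exact isInvertible_mfderiv_extChartAt hm

theorem exists_cotangentEquiv {x₀ m : M} (hm : m ∈ (extChartAt 𝓘(𝕜, E) x₀).source) :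
    ∃ L : (E →L[𝕜] 𝕜) ≃ₗ[𝕜] Cotangent 𝕜 E m, ∀ ℓ, L ℓ = ℓ.comp (chartDifferential 𝕜 E x₀ m) := by
  obtain ⟨A, hA⟩ := isInvertible_chartDifferential hm
  refine ⟨(A.symm.arrowCongr (ContinuousLinearEquiv.refl 𝕜 𝕜)).toLinearEquiv, fun ℓ => ?_⟩
  rw [← hA]
  ext v
  simp

/-- Every covector is the differential of a smooth function. -/
theorem exists_differential_eq {m : M} (α : Cotangent 𝕜 E m) :
    ∃ f : M → 𝕜, SmoothNear 𝕜 E f m ∧ differential E f m = α := by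
  have hm := mem_extChartAt_source (I := 𝓘(𝕜, E)) m
  obtain ⟨L, hL⟩ := exists_cotangentEquiv hm
  refine ⟨L.symm α ∘ extChartAt 𝓘(𝕜, E) m, ⟨_, isOpen_extChartAt_source m, hm,
    smoothOn_comp_extChartAt m (L.symm α).contDiff⟩, ?_⟩
  rw [differential_comp_extChartAt hm (L.symm α).differentiableAt, ContinuousLinearMap.fderiv,
    ← hL, LinearEquiv.apply_symm_apply]

theorem SmoothOn.contDiffOn_comp_symm {x₀ : M} {F : M → 𝕜} {N : Set M}
    (hF : SmoothOn 𝕜 E F N) :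
    ContDiffOn 𝕜 ∞ (F ∘ (extChartAt 𝓘(𝕜, E) x₀).symm)
      ((extChartAt 𝓘(𝕜, E) x₀).target ∩ (extChartAt 𝓘(𝕜, E) x₀).symm ⁻¹' N) := by
  rw [← contMDiffOn_iff_contDiffOn]
  exact ContMDiffOn.comp hF ((contMDiffOn_extChartAt_symm x₀).mono Set.inter_subset_left)
    fun x hx => hx.2

theorem differential_eq_comp {x₀ m : M} {F : M → 𝕜} {N : Set M} (hN : IsOpen N)
    (hF : SmoothOn 𝕜 E F N) (hm : m ∈ (extChartAt 𝓘(𝕜, E) x₀).source) (hmN : m ∈ N) :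
    differential E F m =
      (fderiv 𝕜 (F ∘ (extChartAt 𝓘(𝕜, E) x₀).symm) (extChartAt 𝓘(𝕜, E) x₀ m)).comp
        (chartDifferential 𝕜 E x₀ m) := by
  rw [← differential_comp_extChartAt hm]
  · refine Filter.EventuallyEq.mfderiv_eq ?_
    filter_upwards [(isOpen_extChartAt_source x₀).mem_nhds hm] with y hy
    rw [Function.comp_apply, Function.comp_apply, (extChartAt 𝓘(𝕜, E) x₀).left_inv hy]
  · exact (hF.contDiffOn_comp_symm.contDiffAt ((isOpen_chart_image hN).mem_nhds
      (mem_chart_image hm hmN))).differentiableAt (by simp)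

theorem linearIndependent_differential_iff {x₀ m : M} {ι : Type*} {F : ι → M → 𝕜} {N : Set M}
    (hN : IsOpen N) (hF : ∀ i, SmoothOn 𝕜 E (F i) N)
    (hm : m ∈ (extChartAt 𝓘(𝕜, E) x₀).source) (hmN : m ∈ N) :
    LinearIndependent 𝕜 (fun i => differential E (F i) m) ↔
      LinearIndependent 𝕜 fun i => fderiv 𝕜 (F i ∘ (extChartAt 𝓘(𝕜, E) x₀).symm)
        (extChartAt 𝓘(𝕜, E) x₀ m) := by
  obtain ⟨L, hL⟩ := exists_cotangentEquiv hm
  rw [← LinearMap.linearIndependent_iff L.toLinearMap L.ker]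
  have : (fun i => differential E (F i) m) = L.toLinearMap ∘ fun i =>
      fderiv 𝕜 (F i ∘ (extChartAt 𝓘(𝕜, E) x₀).symm) (extChartAt 𝓘(𝕜, E) x₀ m) :=
    funext fun i => (differential_eq_comp hN (hF i) hm hmN).trans (hL _).symm
  rw [this]

variable [FiniteDimensional 𝕜 E]

/-- The differentials of independent functions are linearly independent on a dense open set. -/
theorem IndependentNear.exists_linearIndependent {ι : Type*} [Fintype ι] {F : ι → M → 𝕜} {m₀ : M}
    (h : IndependentNear E F m₀) : ∃ N G : Set M, IsOpen N ∧ m₀ ∈ N ∧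
      N ⊆ (extChartAt 𝓘(𝕜, E) m₀).source ∧ IsOpen G ∧ N ⊆ closure G ∧
      ∀ m ∈ G, LinearIndependent 𝕜 fun i => differential E (F i) m := by
  obtain ⟨N₀, hN₀, hmN₀, hF, hdep⟩ := h
  let c := extChartAt 𝓘(𝕜, E) m₀
  let N := N₀ ∩ c.source
  have hN : IsOpen N := hN₀.inter (isOpen_extChartAt_source m₀)
  have hFN : ∀ i, SmoothOn 𝕜 E (F i) N := fun i => (hF i).mono Set.inter_subset_left
  let f : ι → E → 𝕜 := fun i => F i ∘ c.symm
  have hf : ∀ {V : Set M}, V ⊆ N → ∀ i, ContDiffOn 𝕜 ∞ (f i) (c.target ∩ c.symm ⁻¹' V) :=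
    fun hV i => SmoothOn.contDiffOn_comp_symm ((hFN i).mono hV)
  have hiff : ∀ m ∈ N, (LinearIndependent 𝕜 (fun i => differential E (F i) m) ↔
      LinearIndependent 𝕜 fun i => fderiv 𝕜 (f i) (c m)) := fun m hm =>
    linearIndependent_differential_iff hN hFN hm.2 hm
  refine ⟨N, {m | m ∈ N ∧ LinearIndependent 𝕜 fun i => differential E (F i) m}, hN,
    ⟨hmN₀, mem_extChartAt_source m₀⟩, Set.inter_subset_right, ?_, ?_, fun m hm => hm.2⟩
  · rw [isOpen_iff_eventually]
    rintro m ⟨hm, hli⟩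
    have hcont : ContinuousAt (fun m i => fderiv 𝕜 (f i) (c m)) m := by
      refine continuousAt_pi.2 fun i => ?_
      refine ContinuousAt.comp (g := fderiv 𝕜 (f i)) ?_ (continuousAt_extChartAt' hm.2)
      exact ((hf subset_rfl i).continuousOn_fderiv_of_isOpen (isOpen_chart_image hN)
        (by simp)).continuousAt ((isOpen_chart_image hN).mem_nhds (mem_chart_image hm.2 hm))
    filter_upwards [hN.mem_nhds hm, hcont.eventually
      (isOpen_setOfPred_linearIndependent.mem_nhds ((hiff m hm).1 hli))] with m' hm' hli'
    exact ⟨hm', (hiff m' hm').2 hli'⟩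
  · intro m hm
    rw [mem_closure_iff]
    intro V hV hmV
    -- If no point of `V ∩ N` had independent differentials, the functions would be dependent on a
    -- nonempty open subset of it.
    by_contra hempty
    have hVN : IsOpen (V ∩ N) := hV.inter hN
    have hcV := isOpen_chart_image (𝕜 := 𝕜) (E := E) (x₀ := m₀) hVN
    obtain ⟨O', hO', hO'open, ⟨x, hx⟩, Ω, φ, hΩ, hφ, hnv, hzero⟩ := exists_dependence hcV
      ⟨c m, mem_chart_image hm.2 ⟨hmV, hm⟩⟩ (hf Set.inter_subset_right) (by
        rintro x ⟨hx, hxV⟩ hli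
        refine hempty ⟨c.symm x, hxV.1, hxV.2, (hiff _ hxV.2).2 ?_⟩
        rwa [c.right_inv hx])
    refine hdep (c.source ∩ c ⁻¹' O' ∩ N) (fun y hy => hy.2.1)
      ((isOpen_extChartAt_preimage' m₀ hO'open).inter hN)
      ⟨c.symm x, ⟨c.map_target (hO' hx).1, ?_⟩, (hO' hx).2.2⟩
      ⟨Ω, φ, hΩ, hφ, hnv, fun y hy => ?_⟩
    · rw [Set.mem_preimage, c.right_inv (hO' hx).1]
      exact hx
    · have := hzero _ hy.1.2
      simp only [f, Function.comp_apply, c.left_inv hy.1.1] at this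
      exact this

end Charts

/-! ### Complexification of pairings -/

section BaseChange

variable {𝕜 : Type*} [Field 𝕜] [Algebra 𝕜 ℂ] {V : Type*} [AddCommGroup V] [Module 𝕜 V]

theorem baseChange_skew {B : LinearMap.BilinForm 𝕜 V} (hB : B.IsAlt) (x y : ℂ ⊗[𝕜] V) :
    B.baseChange ℂ x y = - B.baseChange ℂ y x := by
  induction x with
  | zero => simp
  | add x x' hx hx' => rw [map_add, LinearMap.add_apply, hx, hx', map_add, neg_add]
  | tmul a v =>
    induction y with
    | zero => simp
    | add y y' hy hy' => rw [map_add, hy, hy', map_add, LinearMap.add_apply, neg_add]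
    | tmul b w =>
      rw [LinearMap.BilinForm.baseChange_tmul, LinearMap.BilinForm.baseChange_tmul, ← hB.neg_eq w v,
        neg_smul, mul_comm]

theorem linearIndependent_one_tmul {ι : Type*} {v : ι → V} (hv : LinearIndependent 𝕜 v) :
    LinearIndependent ℂ fun i => (1 : ℂ) ⊗ₜ[𝕜] v i := by
  let b := (Module.Basis.extend hv.linearIndepOn_id).baseChange ℂ
  let j (i : ι) : hv.linearIndepOn_id.extend (Set.subset_univ _) :=
    ⟨v i, hv.linearIndepOn_id.subset_extend _ (Set.mem_range_self i)⟩
  have hj : Function.Injective j := fun i i' h => hv.injective (congrArg Subtype.val h)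
  have hb : (fun i => (1 : ℂ) ⊗ₜ[𝕜] v i) = b ∘ j := by
    funext i
    simp [b, j]
  rw [hb]
  exact b.linearIndependent.comp _ hj

theorem baseChange_one_tmul_eq_neg {B₁ B₂ : LinearMap.BilinForm 𝕜 V} {x y : V}
    (h : ∀ z, B₁ x z = - B₂ y z) :
    B₁.baseChange ℂ (1 ⊗ₜ x) = - B₂.baseChange ℂ (1 ⊗ₜ y) := by
  refine LinearMap.ext fun w => ?_
  rw [LinearMap.neg_apply]
  induction w with
  | zero => simp
  | add w w' hw hw' => rw [map_add, hw, hw', map_add, neg_add]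
  | tmul a z =>
    rw [LinearMap.BilinForm.baseChange_tmul, LinearMap.BilinForm.baseChange_tmul, h, neg_smul]

end BaseChange

/-! ### From brackets and Lenard chains to continuous families of pairs -/

section Bihamiltonian

variable {𝕜 : Type*} [RCLike 𝕜]
  {E : Type*} [NormedAddCommGroup E] [NormedSpace 𝕜 E]
  {M : Type*} [TopologicalSpace M] [ChartedSpace E M]

namespace BihamiltonianStructure

variable (P : BihamiltonianStructure 𝕜 E M)

theorem isPoisson_fst : IsPoisson P.fst := by
  simpa using P.compatible 1 0

theorem isPoisson_snd : IsPoisson P.snd := by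
  simpa using P.compatible 0 1

theorem complexFst_skew [Algebra 𝕜 ℂ] (m : M) (x y) :
    P.complexFst m x y = - P.complexFst m y x :=
  baseChange_skew (P.isPoisson_fst.alt m) x y

theorem complexSnd_skew [Algebra 𝕜 ℂ] (m : M) (x y) :
    P.complexSnd m x y = - P.complexSnd m y x :=
  baseChange_skew (P.isPoisson_snd.alt m) x y

variable [IsManifold 𝓘(𝕜, E) ∞ M]

/-- Every covector at `m` is the differential of some `f`, so an identity of brackets for all `f` is
an identity of functionals on the cotangent space. -/
theorem IsLenardStep.eventually_eq {P : BihamiltonianStructure 𝕜 E M} [Algebra 𝕜 ℂ] {m₀ : M}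
    {F G : M → 𝕜} (h : P.IsLenardStep m₀ F G) :
    ∀ᶠ m in 𝓝 m₀, P.complexFst m (1 ⊗ₜ differential E G m) =
      - P.complexSnd m (1 ⊗ₜ differential E F m) := by
  filter_upwards [h.2.2] with m hm
  refine baseChange_one_tmul_eq_neg fun z => ?_
  obtain ⟨f, hf, rfl⟩ := exists_differential_eq z
  rw [eq_neg_iff_add_eq_zero, add_comm, ← eq_neg_iff_add_eq_zero]
  exact hm f hf

theorem _root_.Bihamiltonian.IsCasimirNear.eventually_eq {P : BihamiltonianStructure 𝕜 E M}
    [Algebra 𝕜 ℂ] {m₀ : M} {F : M → 𝕜} (h : IsCasimirNear P.fst m₀ F) :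
    ∀ᶠ m in 𝓝 m₀, P.complexFst m (1 ⊗ₜ differential E F m) = 0 := by
  filter_upwards [h.2] with m hm
  have := baseChange_one_tmul_eq_neg (B₁ := P.fst m) (B₂ := P.fst m)
    (x := differential E F m) (y := 0) fun z => by
      obtain ⟨f, hf, rfl⟩ := exists_differential_eq z
      rw [map_zero, LinearMap.zero_apply, neg_zero]
      exact hm f hf
  rw [TensorProduct.tmul_zero, map_zero, neg_zero] at this
  exact this

variable [FiniteDimensional 𝕜 E]

/-- In the basis of differentials of chart coordinates the Gram matrices are the brackets of the
coordinates, which are smooth. -/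
theorem isContinuousFamilyAt [Algebra 𝕜 ℂ] [IsScalarTower ℝ 𝕜 ℂ] (m₀ : M) :
    IsContinuousFamilyAt P.complexFst P.complexSnd (Module.finrank 𝕜 E) m₀ := by
  let c := extChartAt 𝓘(𝕜, E) m₀
  have hsource : c.source ∈ 𝓝 m₀ := extChartAt_source_mem_nhds m₀
  let D : Module.Basis (Fin (Module.finrank 𝕜 E)) 𝕜 (E →L[𝕜] 𝕜) :=
    ((Module.finBasis 𝕜 E).dualBasis).map LinearMap.toContinuousLinearMap
  let x : Fin (Module.finrank 𝕜 E) → M → 𝕜 := fun i => D i ∘ c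
  have hx : ∀ i, SmoothOn 𝕜 E (x i) c.source := fun i => smoothOn_comp_extChartAt m₀ (D i).contDiff
  have hdx : ∀ i, ∀ m ∈ c.source,
      differential E (x i) m = (D i).comp (chartDifferential 𝕜 E m₀ m) := by
    intro i m hm
    rw [differential_comp_extChartAt hm (D i).differentiableAt, ContinuousLinearMap.fderiv]
  -- The scalar tower makes the structure map linear over `ℝ`, hence continuous; an arbitrary ring
  -- homomorphism to `ℂ` need not be.
  have halg : Continuous (algebraMap 𝕜 ℂ) :=
    (IsScalarTower.toAlgHom ℝ 𝕜 ℂ).toLinearMap.continuous_of_finiteDimensional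
  have hcont : ∀ {η : PairingField 𝕜 E M}, IsPoisson η → ∀ i j,
      ContinuousAt (fun m => algebraMap 𝕜 ℂ (bracket η (x i) (x j) m)) m₀ := by
    intro η hη i j
    have h := hη.smooth _ (isOpen_extChartAt_source m₀) _ _ (hx i) (hx j)
    exact halg.continuousAt.comp (ContMDiffOn.continuousOn h |>.continuousAt hsource)
  refine ⟨fun m => Matrix.of fun i j => algebraMap 𝕜 ℂ (bracket P.fst (x i) (x j) m),
    fun m => Matrix.of fun i j => algebraMap 𝕜 ℂ (bracket P.snd (x i) (x j) m),
    hcont P.isPoisson_fst, hcont P.isPoisson_snd, ?_⟩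
  filter_upwards [hsource] with m hm
  obtain ⟨L, hL⟩ := exists_cotangentEquiv (𝕜 := 𝕜) (E := E) hm
  refine ⟨(D.map L).baseChange ℂ, fun i j => ?_⟩
  have hb : ∀ i, (D.map L).baseChange ℂ i = 1 ⊗ₜ differential E (x i) m := by
    intro i
    rw [Module.Basis.baseChange_apply, Module.Basis.map_apply, hL, hdx i m hm]
  rw [hb, hb, complexFst, complexSnd, LinearMap.BilinForm.baseChange_tmul,
    LinearMap.BilinForm.baseChange_tmul, mul_one, ← Algebra.algebraMap_eq_smul_one,
    ← Algebra.algebraMap_eq_smul_one]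
  exact ⟨rfl, rfl⟩

/-- Arbitrarily close to `m₀` there are points at which the action dimension is at most the action
dimension at `m₀`. -/
theorem frequently_numKroneckerBlocks_le [Algebra 𝕜 ℂ] [IsScalarTower ℝ 𝕜 ℂ] {m₀ : M} {K : ℕ}
    (hK : (K : ℝ) = P.actionDimAt m₀) :
    ∃ᶠ m in 𝓝 m₀, Module.finrank 𝕜 E +
      numKroneckerBlocks (P.complexFst m) (P.complexSnd m) ≤ 2 * K := by
  have hdim := fun m : M => (P.isContinuousFamilyAt m).eventually_finrank.self_of_nhds
  -- The lower limit of a real function is informative only under a bound; here the action dimension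
  -- is at most `n`.
  have hbdd : Filter.IsBoundedUnder (· ≤ ·) (𝓝 m₀)
      fun m => linearActionDim (P.complexFst m) (P.complexSnd m) := by
    refine ⟨Module.finrank 𝕜 E, Filter.eventually_map.2 (Filter.Eventually.of_forall fun m => ?_)⟩
    obtain ⟨_, hn⟩ := hdim m
    obtain ⟨k, F, -⟩ := exists_maximal_frame (P.complexFst_skew m) (P.complexSnd_skew m)
    have h : (numKroneckerBlocks (P.complexFst m) (P.complexSnd m) : ℝ) ≤ Module.finrank 𝕜 E := by
      exact_mod_cast hn ▸ F.splitsKroneckerBlocks.le_finrank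
    rw [linearActionDim, hn]
    linarith
  -- Twice the action dimension is an integer, so a value below `K + 1 / 2` is at most `K`.
  have hlt : Filter.liminf (fun m => linearActionDim (P.complexFst m) (P.complexSnd m)) (𝓝 m₀) <
      K + 1 / 2 := by
    have : Filter.liminf (fun m => linearActionDim (P.complexFst m) (P.complexSnd m)) (𝓝 m₀) = K :=
      hK.symm
    rw [this]
    norm_num
  refine (Filter.frequently_lt_of_liminf_lt hbdd.isCoboundedUnder_ge hlt).mono fun m hm => ?_
  rw [linearActionDim, (hdim m).2] at hm
  have : (Module.finrank 𝕜 E : ℝ) + numKroneckerBlocks (P.complexFst m) (P.complexSnd m) <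
      2 * K + 1 := by linarith
  have : Module.finrank 𝕜 E + numKroneckerBlocks (P.complexFst m) (P.complexSnd m) <
      2 * K + 1 := by exact_mod_cast this
  omega

end BihamiltonianStructure

end Bihamiltonian

end Bihamiltonian

end

/-! ### The theorem -/

theorem mainTheorem6
    {𝕜 : Type*} [RCLike 𝕜] [Algebra 𝕜 ℂ] [IsScalarTower ℝ 𝕜 ℂ]
    {E : Type*} [NormedAddCommGroup E] [NormedSpace 𝕜 E] [FiniteDimensional 𝕜 E]
    {M : Type*} [TopologicalSpace M] [ChartedSpace E M] [IsManifold 𝓘(𝕜, E) ∞ M]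
    (P : Bihamiltonian.BihamiltonianStructure 𝕜 E M) (m₀ : M)
    (hP : P.IsStrictlyLenardIntegrableAt m₀) :
    ∃ U : Set M, IsOpen U ∧ m₀ ∈ closure U ∧ P.IsHomogeneousOn U := by
  obtain ⟨r, k, H, ⟨hscheme, hcount⟩, hstep⟩ := hP
  have hdim := fun m : M => (P.isContinuousFamilyAt m).eventually_finrank.self_of_nhds
  have hfreq := P.frequently_numKroneckerBlocks_le hcount
  -- This keeps the natural subtraction in the bound `ρ` below from being truncated.
  have hn : Module.finrank 𝕜 E ≤ 2 * ∑ t, (k t + 1) := by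
    obtain ⟨m, hm⟩ := hfreq.exists
    omega
  obtain ⟨N, G, hN, hmN, -, hG, hNG, hli⟩ := hscheme.independent.exists_linearIndependent
  -- The neighbourhoods may shrink with `i`, so only finitely many steps are used: `∑ k t + n` of
  -- them leave `n` steps after the last independent function of each chain.
  have hchain : ∀ᶠ m in 𝓝 m₀, (∀ t, P.complexFst m
      (1 ⊗ₜ Bihamiltonian.differential E (H t 0) m) = 0) ∧
      ∀ t, ∀ i ∈ Finset.range (∑ t, k t + Module.finrank 𝕜 E),
        P.complexFst m (1 ⊗ₜ Bihamiltonian.differential E (H t (i + 1)) m) =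
          - P.complexSnd m (1 ⊗ₜ Bihamiltonian.differential E (H t i) m) :=
    (Filter.eventually_all.2 fun t => (hscheme.casimir t).eventually_eq).and
      (Filter.eventually_all.2 fun t => (Filter.eventually_all_finset _).2 fun i _ =>
        (hstep t i).eventually_eq)
  obtain ⟨O, hO, hOopen, hmO⟩ := eventually_nhds_iff.1 hchain
  obtain ⟨U, hU, hmU, l, κ, hκ⟩ := Bihamiltonian.exists_isOpen_isKroneckerSum
    (ρ := 2 * ∑ t, (k t + 1) - Module.finrank 𝕜 E) (hN.inter hOopen) ⟨hmN, hmO⟩ hG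
    (Set.inter_subset_left.trans hNG) (fun m _ => P.isContinuousFamilyAt m) P.complexFst_skew
    P.complexSnd_skew (hfreq.mono fun m hm => by omega) fun m hm hρ => by
      obtain ⟨_, hnm⟩ := hdim m
      obtain ⟨h0, hs⟩ := hO m hm.1.2
      obtain ⟨κ, F, hF⟩ := Bihamiltonian.exists_frame_compl_eq_bot_of_chains
        (P.complexFst_skew m) (P.complexSnd_skew m) (k₀ := k)
        (q := fun t i => 1 ⊗ₜ Bihamiltonian.differential E (H t i) m)
        (D := ∑ t, k t + Module.finrank 𝕜 E)
        (fun t => by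
          rw [hnm]
          exact Nat.add_le_add_right
            (Finset.single_le_sum (f := k) (fun _ _ => Nat.zero_le _) (Finset.mem_univ t)) _)
        h0 (fun t i hi => hs t i (Finset.mem_range.2 hi))
        (Bihamiltonian.linearIndependent_one_tmul (hli m hm.2)) (by rw [hnm]; omega)
      exact ⟨_, κ, F, hF⟩
  exact ⟨U, hU, hmU, l, κ, hκ⟩
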